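/- Let $\lambda$ be a regular uncountable cardinal and let $S\subseteq\{\delta<\lambda^+:\operatorname{cf}(\delta)=\lambda\}$ be stationary in $\lambda^+$. Then there are a filter $D$ on $\lambda^+$ and a sequence $\langle (C_\delta,h_\delta,\chi_\delta):\delta\in S\rangle$ such that the following hold, where $D^+$ denotes the family of all $A\subseteq\lambda^+$ with $\lambda^+\setminus A\notin D$, and $\operatorname{acc}(E)$ denotes the set of all limit ordinals $\delta<\lambda^+$ with $\delta=\sup(E\cap\delta)$. (A) $D$ is a normal filter on $\lambda^+$ (proper, containing all final segments, closed under diagonal intersections). (B) For $\delta\in S$, $C_\delta$ is a club of $\delta$ of the form $C_\delta=\{\alpha_{\delta,\zeta}:\zeta<\lambda\}$ with $\alpha_{\delta,\zeta}$ strictly increasing and continuous in $\zeta$. (C) For $\delta\in S$, $\chi_\delta\le\lambda$ is a cardinal and $h_\delta$ is a function from $C_\delta$ to $\chi_\delta$. (D) If $A\in D^+$ and $E$ is a club of $\lambda^+$, then the set $$B_{E,A}=\bigl\{\delta\in A\cap S\cap\operatorname{acc}(E):\ \text{for each } i<\chi_\delta,\ \{\zeta<\lambda:\alpha_{\delta,\zeta}\in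 E,\ \alpha_{\delta,\zeta+1}\in E,\ h_\delta(\alpha_{\delta,\zeta})=i\}\ \text{is stationary in }\lambda\bigr\}$$ belongs to $D^+$; moreover, for some $\alpha<\lambda^+$ and $\zeta<\lambda$, the set $\{\delta\in B_{E,A}:\alpha=\alpha_{\delta,\zeta}\}$ belongs to $D^+$. (E) If $\gamma<\lambda^+$ and $\chi$ is a cardinal satisfying one of the conditions below, then $\{\delta\in S:\gamma=\min(C_\delta)\text{ and }\chi_\delta=\chi\}\in D^+$. Here "inaccessible" means weakly inaccessible (uncountable, regular, limit). - ($\alpha$) $\lambda=\chi^+$. - ($\beta$) $\lambda$ is inaccessible but not strongly inaccessible, $0<\chi<\lambda$, and there are a tree $T$ with fewer than $\lambda$ nodes and a set $\Gamma$ of branches (maximal chains) of $T$ with $|\Gamma|=\lambda$ such that, whenever $T'\subseteq T$ is downward closed and $\lambda$ many $\eta\in\Gamma$ are branches of $T'$ (that is, are contained in $T'$), $T'$ has an antichain (a set of pairwise incomparable nodes) of cardinality at least $\chi$. - ($\gamma$) $\lambda$ is inaccessible but not strongly inaccessible, and $\chi$ is the least cardinal such that $\chi^\theta\ge\lambda$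 for some $\theta\le\chi$. - ($\delta$) $\lambda$ is strongly inaccessible, $0<\chi<\lambda$, and $\lambda$ is not ineffable, in the sense that there is a sequence $\langle A_\mu:\mu<\lambda\text{ inaccessible}\rangle$ with $A_\mu\subseteq\mu$ such that there are no stationary set $\Gamma\subseteq\{\mu<\lambda:\mu\text{ inaccessible}\}$ and no $A\subseteq\lambda$ with $A_\mu=A\cap\mu$ for all $\mu\in\Gamma$. -/

import Mathlib

open Cardinal

universe u

namespace ClubGuess

/-- The cardinal `κ`, viewed as the well-ordered set of all ordinals below it. -/
abbrev Below (κ : Cardinal.{u}) : Type (u + 1) := Set.Iio κ.ord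

/-- On an infinite cardinal `κ`, `Order.succ` is the ordinal successor `ζ ↦ ζ + 1`. -/
theorem coe_succ_below {κ : Cardinal.{u}} (hκ : ℵ₀ ≤ κ) (ζ : Below κ) :
    ((Order.succ ζ : Below κ) : Ordinal.{u}) = (ζ : Ordinal.{u}) + 1 := by
  have hlim : (ζ : Ordinal.{u}) + 1 < κ.ord :=
    (Cardinal.isSuccLimit_ord hκ).add_one_lt ζ.2
  have h : Order.succ ζ = (⟨(ζ : Ordinal.{u}) + 1, hlim⟩ : Below κ) := by
    have hlt : ζ < (⟨(ζ : Ordinal.{u}) + 1, hlim⟩ : Below κ) := by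
      rw [← Subtype.coe_lt_coe]
      exact lt_add_one _
    apply le_antisymm (Order.succ_le_of_lt hlt)
    have h2 : ζ < Order.succ ζ := Order.lt_succ_of_not_isMax (fun hm => (hm.not_lt hlt))
    rw [← Subtype.coe_le_coe]
    exact Order.add_one_le_of_lt (Subtype.coe_lt_coe.2 h2)
  rw [h]

/-- The limit points `δ` of `E`, i.e. `δ > 0` and `E ∩ δ` is unbounded in `δ`. -/
def acc {κ : Cardinal.{u}} (E : Set (Below κ)) : Set (Below κ) :=
  {δ | (δ : Ordinal.{u}) ≠ 0 ∧ ∀ β < δ, ∃ γ ∈ E, β < γ ∧ γ < δ}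

/-- `A ∈ D⁺`: the complement of `A` is not in `D`. -/
def Positive {X : Type*} (D : Filter X) (A : Set X) : Prop := Aᶜ ∉ D

/-- A normal filter on `κ`: a proper filter that contains all final segments and is closed under
diagonal intersections. -/
structure IsNormalFilter {κ : Cardinal.{u}} (D : Filter (Below κ)) : Prop where
  proper : ∅ ∉ D
  tail_mem : ∀ α : Below κ, Set.Ioi α ∈ D
  diag_mem : ∀ F : Below κ → Set (Below κ), (∀ α, F α ∈ D) → {β | ∀ α < β, β ∈ F α} ∈ D

/-- Weakly inaccessible: an uncountable regular limit cardinal.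
(Mathlib's `Cardinal.IsInaccessible` is strong inaccessibility.) -/
def IsWeaklyInaccessible (κ : Cardinal.{u}) : Prop :=
  ℵ₀ < κ ∧ κ.IsRegular ∧ Order.IsSuccLimit κ

/-- The (weakly) inaccessible cardinals below `κ`, as ordinals. -/
def inaccBelow (κ : Cardinal.{u}) : Set (Below κ) :=
  {μ | ∃ m : Cardinal.{u}, IsWeaklyInaccessible m ∧ (μ : Ordinal.{u}) = m.ord}

/-- A tree: a partial order in which the predecessors of each node are well-ordered. -/
def IsTree (T : Type u) [PartialOrder T] : Prop :=
  ∀ t : T, IsWellOrder (Set.Iio t) (· < ·)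

/-- A branch of a tree: a maximal chain. -/
def IsBranch {T : Type u} [PartialOrder T] (η : Set T) : Prop :=
  IsMaxChain (· ≤ ·) η

/-- There are a tree `T` with fewer than `κ` nodes and a set `Γ` of `κ` branches of it such that
every downward closed `T' ⊆ T` through which `κ` members of `Γ` run has an antichain of
cardinality at least `χ`. -/
def HasTree (κ χ : Cardinal.{u}) : Prop :=
  ∃ (T : Type u) (_ : PartialOrder T) (Γ : Set (Set T)),
    IsTree T ∧ #T < κ ∧ (∀ η ∈ Γ, IsBranch η) ∧ #Γ = κ ∧
    ∀ T' : Set T, IsLowerSet T' → #{η : Set T | η ∈ Γ ∧ η ⊆ T'} = κ →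
      ∃ A ⊆ T', IsAntichain (· ≤ ·) A ∧ χ ≤ #A

/-- Non-ineffability (used for strongly inaccessible `κ`; automatic when `κ` is not Mahlo): there are `A_μ ⊆ μ`, for `μ < κ` inaccessible, such that no `B ⊆ κ`
satisfies `A_μ = B ∩ μ` on a stationary set of inaccessible `μ`. -/
def NotIneffable (κ : Cardinal.{u}) : Prop :=
  ∃ A : Below κ → Set (Below κ), (∀ μ ∈ inaccBelow κ, A μ ⊆ Set.Iio μ) ∧
    ¬ ∃ Γ ⊆ inaccBelow κ, IsStationary Γ ∧ ∃ B : Set (Below κ), ∀ μ ∈ Γ, A μ = B ∩ Set.Iio μ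

/-- The list of conditions on the number `χ` of colours. -/
inductive Admissible (κ χ : Cardinal.{u}) : Prop
  | succ (h : κ = Order.succ χ)
  | tree (h1 : IsWeaklyInaccessible κ) (h2 : ¬ κ.IsInaccessible) (h3 : 0 < χ) (h4 : χ < κ)
      (h5 : HasTree κ χ)
  | power (h1 : IsWeaklyInaccessible κ) (h2 : ¬ κ.IsInaccessible)
      (h3 : IsLeast {x : Cardinal.{u} | ∃ θ ≤ x, κ ≤ x ^ θ} χ)
  | ineffable (h1 : κ.IsInaccessible) (h2 : NotIneffable κ) (h3 : 0 < χ) (h4 : χ < κ)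

/-- The set of `δ ∈ A ∩ S ∩ acc E` such that for each colour `i < χ_δ`, the set of `ζ < κ` with
`α_{δ,ζ} ∈ E`, `α_{δ,ζ+1} ∈ E` and `h_δ(α_{δ,ζ}) = i` is stationary in `κ`. -/
def guessSet {κ : Cardinal.{u}} (S : Set (Below (Order.succ κ)))
    (a : Below (Order.succ κ) → Below κ → Below (Order.succ κ))
    (h : Below (Order.succ κ) → Below (Order.succ κ) → Ordinal.{u})
    (χ : Below (Order.succ κ) → Cardinal.{u})
    (E A : Set (Below (Order.succ κ))) : Set (Below (Order.succ κ)) :=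
  {δ | δ ∈ A ∧ δ ∈ S ∧ δ ∈ acc E ∧ ∀ i < (χ δ).ord,
    IsStationary {ζ : Below κ | a δ (Order.succ ζ) ∈ E ∧ h δ (a δ ζ) = i ∧ a δ ζ ∈ E}}

end ClubGuess

universe v w

namespace ClubGuess

open Set Filter Order

/-! The filter `D` is generated by the sets `guessSet S a h χ E univ`, one for each club `E`. It is
proper as soon as every club is guessed, with all colours, at some `δ ∈ S`. It is normal because the
ladder of `δ` eventually passes every `α < δ`, so that guessing a diagonal intersection implies
guessing each of its earlier terms. A positive set stays positive after intersection with a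
generator, and a regressive function has a positive fibre on it; this is (D). For (E), Solovay's
method splits `S` into stationary pieces indexed by pairs (first point, number of colours), and
every piece is made to guess all clubs by itself.

Guessing: if `δ` is a limit of `E`, a ladder of `δ` lies in `E` at club many indices, so only the
successor points matter. `exists_weak_guess` finds bounds `F δ ζ < δ` such that each club meets the
intervals `(al δ ζ, F δ ζ]` for stationarily many `ζ` at some `δ`. Without such bounds, `ω`
refinements give a club `E` and thinned ladders closed under "next point of `E`". This operation
does not depend on `δ`, so two thinned ladders sharing a point stay together up to the smaller `δ`,
which then has too small a cofinality. `exists_guess` moves `F δ ζ` down into a club; failing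
forever would give a descending sequence of ordinals. The ladders are then rebuilt to step from `al
δ ζ` to `F δ ζ`.

Colours: `Splits Y J` gives `#Y` test sets such that every stationary set is cut into `#J`
stationary parts by disjoint ones among them. `exists_colouring` makes the choice of test sets at
each `δ` independent of the club: otherwise `#Y` successive clubs would each destroy a new test set
out of fewer than `#Y`. Each admissible condition yields `Splits`: successors by Solovay's argument
at points of small cofinality, the tree condition through nodes on stationarily many branches, the
power condition through a tree of functions, and non-ineffability through the tree of traces of the
`A_μ`. -/

/-- A well-order of the type of a regular uncountable cardinal. -/
class UncountableRegularOrder (α : Type v) [LinearOrder α] [WellFoundedLT α] : Prop extends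
    IsRegularCardinalOrder α where
  aleph0_lt_cof : ℵ₀ < Order.cof α

/-! ### Clubs in regular uncountable well-orders -/

section Basic

variable {α : Type v} [LinearOrder α] [WellFoundedLT α] [UncountableRegularOrder α]

open UncountableRegularOrder

theorem aleph0_lt_mk (α : Type v) [LinearOrder α] [WellFoundedLT α] [UncountableRegularOrder α] :
    ℵ₀ < #α := by
  rw [← Order.cof_eq_cardinalMk (α := α)]; exact aleph0_lt_cof

theorem nonempty_of_uncountable (α : Type v) [LinearOrder α] [WellFoundedLT α]
    [UncountableRegularOrder α] : Nonempty α :=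
  Order.cof_ne_zero_iff.1 ((aleph0_pos.trans aleph0_lt_cof).ne')

theorem exists_gt_of_mk_lt {s : Set α} (hs : #s < #α) : ∃ b, ∀ x ∈ s, x < b := by
  rw [← not_isCofinal_iff]
  intro h
  rw [← Order.cof_eq_cardinalMk (α := α)] at hs
  exact (Order.cof_le h).not_gt hs

theorem exists_gt_range {ι : Type v} (hι : #ι < #α) (f : ι → α) : ∃ b, ∀ i, f i < b := by
  obtain ⟨b, hb⟩ := exists_gt_of_mk_lt (s := range f) (mk_range_le.trans_lt hι)
  exact ⟨b, fun i => hb _ ⟨i, rfl⟩⟩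

theorem exists_gt_seq (f : ℕ → α) : ∃ b, ∀ n, f n < b := by
  obtain ⟨b, hb⟩ := exists_gt_of_mk_lt (s := range f) (by
    have : #(range f) ≤ ℵ₀ := Cardinal.mk_le_aleph0_iff.2 (countable_range f).to_subtype
    exact this.trans_lt (aleph0_lt_mk α))
  exact ⟨b, fun i => hb _ ⟨i, rfl⟩⟩

instance (priority := low) noMaxOrder_of_uncountable : NoMaxOrder α where
  exists_gt a := by
    obtain ⟨b, hb⟩ := exists_gt_seq (fun _ : ℕ => a)
    exact ⟨b, hb 0⟩

theorem mk_Iio_lt (a : α) : #(Iio a) < #α := by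
  have h : Ordinal.type (α := Iio a) (· < ·) < Ordinal.type (α := α) (· < ·) :=
    Ordinal.typein_lt_type (α := α) (· < ·) a
  rw [← Cardinal.ord_cardinalMk (α := α), Cardinal.lt_ord, Ordinal.card_type] at h
  exact h

theorem mk_Iic_lt (a : α) : #(Iic a) < #α := by
  obtain ⟨b, hb⟩ := exists_gt a
  exact (mk_le_mk_of_subset (fun x (hx : x ≤ a) => hx.trans_lt hb)).trans_lt (mk_Iio_lt b)

theorem mk_eq_of_unbounded {s : Set α} (hs : ∀ b, ∃ x ∈ s, b < x) : #s = #α := by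
  refine (mk_set_le s).antisymm (not_lt.1 fun h => ?_)
  obtain ⟨b, hb⟩ := exists_gt_of_mk_lt h
  obtain ⟨x, hx, hbx⟩ := hs b
  exact (hb x hx).not_gt hbx

theorem exists_isLUB {β : Type*} [LinearOrder β] [WellFoundedLT β] {s : Set β}
    (h : (upperBounds s).Nonempty) : ∃ x, IsLUB s x :=
  ⟨WellFounded.min wellFounded_lt _ h, WellFounded.min_mem _ _ h,
    fun _ hy => not_lt.1 (WellFounded.not_lt_min wellFounded_lt _ hy)⟩

/-- Clubs contain limits of increasing interleaved sequences. -/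
theorem mem_of_isLUB_of_interleaved {α : Type*} [LinearOrder α] {E : Set α} (hE : IsClub E)
    {s : Set α} {x : α} (hs : IsLUB s x) (hne : s.Nonempty) (h : ∀ y ∈ s, ∃ e ∈ E, y ≤ e ∧ ∃ z ∈ s, e ≤ z) : x ∈ E := by
  refine hE.isLUB_mem (t := {e | e ∈ E ∧ ∃ z ∈ s, e ≤ z}) (fun e he => he.1) ?_ ⟨?_, ?_⟩
  · obtain ⟨y, hy⟩ := hne
    obtain ⟨e, he, -, z⟩ := h y hy
    exact ⟨e, he, z⟩
  · rintro e ⟨-, z, hz, hez⟩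
    exact hez.trans (hs.1 hz)
  · intro b hb
    refine hs.2 fun y hy => ?_
    obtain ⟨e, he, hye, z⟩ := h y hy
    exact hye.trans (hb ⟨he, z⟩)

theorem isClub_Ioi (a : α) : IsClub (Ioi a) := by
  refine ⟨fun s hs hne _ x hx => ?_, fun b => ?_⟩
  · obtain ⟨y, hy⟩ := hne
    exact lt_of_lt_of_le (hs hy : a < y) (hx.1 hy)
  · obtain ⟨c, hc⟩ := exists_gt (max a b)
    exact ⟨c, (le_max_left _ _).trans_lt hc, ((le_max_right _ _).trans_lt hc).le⟩

theorem isClub_diag {E : α → Set α} (hE : ∀ a, IsClub (E a)) :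
    IsClub {b | ∀ a < b, b ∈ E a} := by
  refine ⟨fun s hs hne _ x hx a hax => ?_, fun a => ?_⟩
  · obtain ⟨c, hc, hac⟩ := (lt_isLUB_iff hx).1 hax
    refine (hE a).isLUB_mem (t := s ∩ Ici c) (fun y hy => hs hy.1 a (hac.trans_le hy.2)) ⟨c, hc, le_rfl⟩
      ⟨fun y hy => hx.1 hy.1, fun b hb => hx.2 fun y hy => ?_⟩
    obtain h | h := le_total c y
    · exact hb ⟨hy, h⟩
    · exact h.trans (hb ⟨hc, le_rfl⟩)
  -- For unboundedness, iterate `ω` times a step from `x` into all `E c` with `c ≤ x`, and take the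
  -- supremum.
  · have key : ∀ x : α, ∃ y, x < y ∧ ∀ c ≤ x, y ∈ E c := by
      intro x
      have hc : IsClub (⋂ c : Iic x, E c) :=
        IsClub.iInter aleph0_lt_cof.ne'
          (by simpa [Order.cof_eq_cardinalMk] using mk_Iic_lt x) fun c => hE c
      obtain ⟨z, hz⟩ := exists_gt x
      obtain ⟨y, hy, hzy⟩ := hc.isCofinal z
      exact ⟨y, hz.trans_le hzy, fun c hc => mem_iInter.1 hy ⟨c, hc⟩⟩
    choose f hf hfE using key
    have hmono : StrictMono fun n : ℕ => f^[n] a := strictMono_nat_of_lt_succ fun n => by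
      rw [Function.iterate_succ_apply']; exact hf _
    obtain ⟨b, hb⟩ := exists_gt_seq fun n : ℕ => f^[n] a
    obtain ⟨x, hx⟩ := exists_isLUB (s := range fun n : ℕ => f^[n] a)
      ⟨b, by rintro _ ⟨n, rfl⟩; exact (hb n).le⟩
    refine ⟨x, fun c hcx => ?_, hx.1 ⟨0, rfl⟩⟩
    obtain ⟨_, ⟨n, rfl⟩, hcn⟩ := (lt_isLUB_iff hx).1 hcx
    refine mem_of_isLUB_of_interleaved (hE c) hx ⟨_, 0, rfl⟩ ?_
    rintro _ ⟨m, rfl⟩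
    refine ⟨f^[max m n + 1] a, ?_, hmono.monotone (by omega), _, ⟨max m n + 1, rfl⟩, le_rfl⟩
    rw [Function.iterate_succ_apply']
    exact hfE _ _ (hcn.le.trans (hmono.monotone (le_max_right _ _)))

end Basic

/-! ### The club filter and Fodor's lemma -/

/-- The filter generated by the clubs. -/
def clubFilter (α : Type v) [LinearOrder α] [WellFoundedLT α] [UncountableRegularOrder α] :
    Filter α where
  sets := {s | ∃ t, IsClub t ∧ t ⊆ s}
  univ_sets := ⟨univ, .univ, subset_rfl⟩
  sets_of_superset := fun ⟨t, ht, h⟩ h' => ⟨t, ht, h.trans h'⟩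
  inter_sets := fun ⟨t, ht, h⟩ ⟨t', ht', h'⟩ =>
    ⟨t ∩ t', ht.inter UncountableRegularOrder.aleph0_lt_cof.ne' ht', inter_subset_inter h h'⟩

section ClubFilter

variable {α : Type v} [LinearOrder α] [WellFoundedLT α] [UncountableRegularOrder α]

theorem mem_clubFilter {s : Set α} : s ∈ clubFilter α ↔ ∃ t, IsClub t ∧ t ⊆ s := Iff.rfl

theorem _root_.IsClub.mem_clubFilter {s : Set α} (h : IsClub s) : s ∈ clubFilter α :=
  ⟨s, h, subset_rfl⟩

theorem isStationary_iff_frequently {s : Set α} :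
    IsStationary s ↔ ∃ᶠ x in clubFilter α, x ∈ s := by
  constructor
  · rintro h ⟨t, ht, h'⟩
    obtain ⟨x, hx, hxt⟩ := h ht
    exact h' hxt hx
  · intro h t ht
    exact (h.and_eventually ht.mem_clubFilter).exists

instance clubFilter_neBot : NeBot (clubFilter α) := by
  refine ⟨fun h => ?_⟩
  obtain ⟨t, ht, h⟩ : ∅ ∈ clubFilter α := h ▸ mem_bot
  have := nonempty_of_uncountable α
  obtain ⟨x, hx⟩ := ht.nonempty
  exact h hx

theorem eventually_clubFilter_gt (a : α) : ∀ᶠ x in clubFilter α, a < x :=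
  (isClub_Ioi a).mem_clubFilter

theorem frequently_exists_gt {p : α → Prop} (h : ∃ᶠ x in clubFilter α, p x) (a : α) :
    ∃ x, p x ∧ a < x :=
  (h.and_eventually (eventually_clubFilter_gt a)).exists

theorem isClub_iInter_small {ι : Type w} (hι : lift.{v} #ι < lift.{w} #α) {E : ι → Set α}
    (hE : ∀ i, IsClub (E i)) : IsClub (⋂ i, E i) :=
  IsClub.iInter UncountableRegularOrder.aleph0_lt_cof.ne'
    (by rwa [Order.cof_eq_cardinalMk]) hE

theorem isClub_iInter_nat {E : ℕ → Set α} (hE : ∀ i, IsClub (E i)) : IsClub (⋂ i, E i) :=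
  IsClub.iInter_of_countable UncountableRegularOrder.aleph0_lt_cof.ne' hE

theorem eventually_all_small {ι : Type w} (hι : lift.{v} #ι < lift.{w} #α) {p : ι → α → Prop}
    (h : ∀ i, ∀ᶠ x in clubFilter α, p i x) : ∀ᶠ x in clubFilter α, ∀ i, p i x := by
  choose t ht h' using fun i => mem_clubFilter.1 (h i)
  exact ⟨_, isClub_iInter_small hι ht, fun x hx i => h' i (mem_iInter.1 hx i)⟩

theorem eventually_all_nat {p : ℕ → α → Prop} (h : ∀ i, ∀ᶠ x in clubFilter α, p i x) :
    ∀ᶠ x in clubFilter α, ∀ i, p i x := by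
  choose t ht h' using fun i => mem_clubFilter.1 (h i)
  exact ⟨_, isClub_iInter_nat ht, fun x hx i => h' i (mem_iInter.1 hx i)⟩

theorem eventually_diag {p : α → α → Prop} (h : ∀ a, ∀ᶠ x in clubFilter α, p a x) :
    ∀ᶠ x in clubFilter α, ∀ a < x, p a x := by
  choose t ht h' using fun i => mem_clubFilter.1 (h i)
  exact ⟨_, isClub_diag ht, fun x hx a ha => h' a (hx a ha)⟩

theorem eventually_closed (f : α → α) : ∀ᶠ x in clubFilter α, ∀ a < x, f a < x :=
  eventually_diag fun a => eventually_clubFilter_gt (f a)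

theorem frequently_exists_small {ι : Type w} (hι : lift.{v} #ι < lift.{w} #α) {p : ι → α → Prop}
    (h : ∃ᶠ x in clubFilter α, ∃ i, p i x) : ∃ i, ∃ᶠ x in clubFilter α, p i x := by
  by_contra hc
  refine h ?_
  simp only [not_exists, not_frequently] at hc ⊢
  exact eventually_all_small hι hc

/-- Fodor's lemma. -/
theorem frequently_fodor {p : α → α → Prop} (h : ∃ᶠ x in clubFilter α, ∃ a < x, p a x) :
    ∃ a, ∃ᶠ x in clubFilter α, p a x := by
  by_contra hc
  refine h ?_
  simp only [not_exists, not_frequently, not_and] at hc ⊢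
  exact eventually_diag hc

end ClubFilter

/-! ### Ladders: normal cofinal sequences -/

section Ladder

/-- The points of `X` below which `E` is unbounded. -/
def limitPoints {X : Type v} [LinearOrder X] (E : Set X) : Set X :=
  {δ | ∀ β < δ, ∃ γ ∈ E, β < γ ∧ γ < δ}

theorem limitPoints_mono {X : Type v} [LinearOrder X] {E E' : Set X} (h : E ⊆ E') :
    limitPoints E ⊆ limitPoints E' := fun _ hδ β hβ =>
  let ⟨γ, hγ, h'⟩ := hδ β hβ
  ⟨γ, h hγ, h'⟩

/-- Recursion taking `a ζ` to be the least point that is at least `γ` and at least all `step ξ (a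
ξ)` with `ξ < ζ`. Leastness gives continuity at limits and the exact value at successors; `hb` keeps
the values below `δ`. -/
theorem exists_normal_of_step {X Y : Type v} [LinearOrder X] [WellFoundedLT X] [LinearOrder Y]
    [WellFoundedLT Y] {δ γ : X} (hγ : γ < δ) (step : Y → X → X)
    (hstep : ∀ ξ, ∀ x < δ, x < step ξ x ∧ step ξ x < δ)
    (hb : ∀ ζ : Y, ∀ f : Iio ζ → X, (∀ i, f i < δ) → ∃ β < δ, ∀ i, f i ≤ β) :
    ∃ a : Y → X, (∀ ζ, a ζ < δ) ∧ IsNormal a ∧ (∀ ζ, IsMin ζ → a ζ = γ) ∧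
      ∀ ζ ζ', ζ ⋖ ζ' → a ζ' = step ζ (a ζ) := by
  classical
  let U : (ζ : Y) → ((ξ : Y) → ξ < ζ → X) → Set X := fun ζ f =>
    {x | γ ≤ x ∧ ∀ ξ (h : ξ < ζ), step ξ (f ξ h) ≤ x}
  let a : Y → X := wellFounded_lt.fix fun ζ f =>
    if h : (U ζ f).Nonempty then WellFounded.min wellFounded_lt _ h else γ
  have ha : ∀ ζ, a ζ = if h : (U ζ fun ξ _ => a ξ).Nonempty then
      WellFounded.min wellFounded_lt _ h else γ := fun ζ =>
    wellFounded_lt.fix_eq _ ζ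
  have key : ∀ ζ, a ζ < δ ∧ γ ≤ a ζ ∧ (∀ ξ < ζ, step ξ (a ξ) ≤ a ζ) ∧
      ∀ x, γ ≤ x → (∀ ξ < ζ, step ξ (a ξ) ≤ x) → a ζ ≤ x := by
    intro ζ
    induction ζ using WellFoundedLT.induction with
    | ind ζ ih =>
    obtain ⟨β, hβ, hβ'⟩ := hb ζ (fun i => step i (a i)) fun i => (hstep i _ (ih i i.2).1).2
    have hU : max γ β ∈ U ζ fun ξ _ => a ξ :=
      ⟨le_max_left _ _, fun ξ h => (hβ' ⟨ξ, h⟩).trans (le_max_right _ _)⟩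
    have hne : (U ζ fun ξ _ => a ξ).Nonempty := ⟨_, hU⟩
    have hm := WellFounded.min_mem (wellFounded_lt (α := X)) _ hne
    have hmin : ∀ x ∈ U ζ fun ξ _ => a ξ, WellFounded.min (wellFounded_lt (α := X)) _ hne ≤ x :=
      fun x hx => not_lt.1 (WellFounded.not_lt_min wellFounded_lt _ hx)
    rw [ha ζ, dif_pos hne]
    exact ⟨(hmin _ hU).trans_lt (max_lt hγ hβ), hm.1, hm.2, fun x h1 h2 => hmin x ⟨h1, h2⟩⟩
  have hmono : StrictMono a := fun ξ ζ h =>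
    (hstep ξ _ (key ξ).1).1.trans_le ((key ζ).2.2.1 ξ h)
  refine ⟨a, fun ζ => (key ζ).1, isNormal_iff.2 ⟨hmono, fun ζ hζ x hx => ?_⟩, fun ζ hζ => ?_,
    fun ζ ζ' h => ?_⟩
  · refine (key ζ).2.2.2 x ?_ fun ξ hξ => ?_
    · obtain ⟨b, hb⟩ := not_isMin_iff.1 hζ.not_isMin
      exact (key b).2.1.trans (hx b hb)
    · obtain ⟨η, hη, hηζ⟩ : ∃ η, ξ < η ∧ η < ζ := by
        by_contra hc
        push Not at hc
        exact hζ.isSuccPrelimit ξ ⟨hξ, fun c h1 h2 => (hc c h1).not_gt h2⟩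
      exact ((key η).2.2.1 ξ hη).trans (hx η hηζ)
  · exact ((key ζ).2.2.2 γ le_rfl fun ξ hξ => (hζ.not_lt hξ).elim).antisymm (key ζ).2.1
  · refine ((key ζ').2.2.2 _ ?_ fun ξ hξ => ?_).antisymm ((key ζ').2.2.1 ζ h.lt)
    · exact (key ζ).2.1.trans (hstep ζ _ (key ζ).1).1.le
    · obtain rfl | hlt := (h.le_of_lt hξ).eq_or_lt
      · exact le_rfl
      · exact ((key ζ).2.2.1 ξ hlt).trans (hstep ζ _ (key ζ).1).1.le

variable {X Y : Type v} [LinearOrder X] [WellFoundedLT X]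
  [LinearOrder Y] [WellFoundedLT Y] [UncountableRegularOrder Y]

/-- A normal function from `Y` that is cofinal in `δ`. -/
structure IsLadder (δ : X) (a : Y → X) : Prop where
  isNormal : IsNormal a
  lt : ∀ ζ, a ζ < δ
  cofinal : ∀ β < δ, ∃ ζ, β < a ζ

theorem exists_isLadder [NoMaxOrder X] {δ : X} (h : Order.cof (Iio δ) = #Y) :
    ∃ a : Y → X, IsLadder δ a := by
  obtain ⟨s, hs, hs'⟩ := Order.exists_cof_eq (Iio δ)
  obtain ⟨e⟩ := Cardinal.eq.1 (h.symm.trans hs'.symm)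
  have hbd : ∀ f : Set (Iio δ), #f < #Y → ∃ β < δ, ∀ x ∈ f, x.1 < β := by
    intro f hf
    rw [← h] at hf
    obtain ⟨b, hb⟩ := not_isCofinal_iff.1 fun hc => (Order.cof_le hc).not_gt hf
    exact ⟨b, b.2, fun x hx => hb x hx⟩
  have hsucc : ∀ x < δ, ∃ y, x < y ∧ y < δ := fun x hx => by
    obtain ⟨β, hβ, hβ'⟩ := hbd {⟨x, hx⟩} (by simpa using one_lt_aleph0.trans (aleph0_lt_mk Y))
    exact ⟨β, hβ' _ rfl, hβ⟩
  choose! sc hsc hsc' using hsucc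
  obtain ⟨γ, hγ, -⟩ := hbd ∅ (by simpa using aleph0_pos.trans (aleph0_lt_mk Y))
  obtain ⟨a, ha, han, -, has⟩ := exists_normal_of_step (Y := Y) hγ
    (fun ξ x => max (sc x) (sc (e ξ).1))
    (fun ξ x hx => ⟨(hsc x hx).trans_le (le_max_left _ _), max_lt (hsc' x hx) (hsc' _ (e ξ).1.2)⟩)
    (fun ζ f hf => by
      obtain ⟨β, hβ, hβ'⟩ := hbd (range fun i => ⟨f i, hf i⟩) (mk_range_le.trans_lt (mk_Iio_lt ζ))
      exact ⟨β, hβ, fun i => (hβ' _ ⟨i, rfl⟩).le⟩)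
  refine ⟨a, han, ha, fun β hβ => ?_⟩
  obtain ⟨y, hy, hβy⟩ := hs ⟨β, hβ⟩
  obtain ⟨ξ, hξ⟩ := e.surjective ⟨y, hy⟩
  let _ := SuccOrder.ofLinearWellFoundedLT Y
  refine ⟨Order.succ ξ, ?_⟩
  rw [has ξ _ (covBy_succ ξ), hξ]
  exact lt_of_le_of_lt hβy ((hsc _ y.2).trans_le (le_max_right _ _))

namespace IsLadder

variable {δ : X} {a : Y → X}

theorem exists_bound (ha : IsLadder δ a) {ι : Type v} (hι : #ι < #Y) (f : ι → X)
    (hf : ∀ i, f i < δ) : ∃ ζ, ∀ i, f i < a ζ := by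
  choose g hg using fun i => ha.cofinal (f i) (hf i)
  obtain ⟨ζ, hζ⟩ := exists_gt_range hι g
  exact ⟨ζ, fun i => (hg i).trans (ha.isNormal.strictMono (hζ i))⟩

/-- At an index closed under a function that jumps past a further point of `E`, the ladder point is
a limit of points of `E`. -/
theorem eventually_mem (ha : IsLadder δ a) {E : Set X} (hE : IsClub E) (hδ : δ ∈ limitPoints E) :
    ∀ᶠ ζ in clubFilter Y, a ζ ∈ E := by
  have h : ∀ ζ, ∃ ζ', ∃ e ∈ E, a ζ < e ∧ e < a ζ' := fun ζ => by
    obtain ⟨e, he, h1, h2⟩ := hδ (a ζ) (ha.lt ζ)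
    obtain ⟨ζ', h3⟩ := ha.cofinal e h2
    exact ⟨ζ', e, he, h1, h3⟩
  choose f hf using h
  have hf' : ∀ ζ, ζ < f ζ := fun ζ => by
    obtain ⟨e, -, h1, h2⟩ := hf ζ
    exact ha.isNormal.strictMono.lt_iff_lt.1 (h1.trans h2)
  obtain ⟨y⟩ := nonempty_of_uncountable Y
  filter_upwards [eventually_closed f, eventually_clubFilter_gt y] with ζ hζ hy
  have hlub : IsLUB (Iio ζ) ζ := ⟨fun x hx => le_of_lt hx, fun b hb => not_lt.1 fun hc =>
    (hb (hζ b hc)).not_gt (hf' b)⟩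
  refine mem_of_isLUB_of_interleaved hE (ha.isNormal.map_isLUB hlub ⟨y, hy⟩) ⟨_, y, hy, rfl⟩ ?_
  rintro _ ⟨ξ, hξ, rfl⟩
  obtain ⟨e, he, h1, h2⟩ := hf ξ
  exact ⟨e, he, h1.le, _, ⟨f ξ, hζ ξ hξ, rfl⟩, h2.le⟩

theorem mem_image_of_isLUB (ha : IsLadder δ a) {K : Set Y} (hK : IsClub K) {Z : Set X}
    (hZ : Z ⊆ a '' K) (hne : Z.Nonempty) {s : X} (hs : IsLUB Z s) (hsδ : s < δ) : s ∈ a '' K := by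
  obtain ⟨ζ₀, hζ₀⟩ := ha.cofinal s hsδ
  obtain ⟨ζ, hζ⟩ := exists_isLUB (s := a ⁻¹' Z ∩ K) ⟨ζ₀, fun ξ hξ =>
    ha.isNormal.strictMono.le_iff_le.1 ((hs.1 hξ.1).trans hζ₀.le)⟩
  have hne' : (a ⁻¹' Z ∩ K).Nonempty := by
    obtain ⟨z, hz⟩ := hne
    obtain ⟨ξ, hξ, rfl⟩ := hZ hz
    exact ⟨ξ, hz, hξ⟩
  have h : a '' (a ⁻¹' Z ∩ K) = Z := by
    ext z
    constructor
    · rintro ⟨ξ, hξ, rfl⟩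
      exact hξ.1
    · intro hz
      obtain ⟨ξ, hξ, rfl⟩ := hZ hz
      exact ⟨ξ, ⟨hz, hξ⟩, rfl⟩
  refine ⟨ζ, hK.isLUB_mem inter_subset_right hne' hζ, ?_⟩
  have := ha.isNormal.map_isLUB hζ hne'
  rw [h] at this
  exact this.unique hs

end IsLadder

theorem limitPoints_mem_clubFilter [UncountableRegularOrder X] {E : Set X} (hE : IsClub E) :
    limitPoints E ∈ clubFilter X := by
  have h : ∀ x : X, ∃ e ∈ E, x < e := fun x => by
    obtain ⟨y, hy⟩ := exists_gt x
    obtain ⟨e, he, hye⟩ := hE.isCofinal y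
    exact ⟨e, he, hy.trans_le hye⟩
  choose f hf hf' using h
  filter_upwards [eventually_closed f] with x hx β hβ
  exact ⟨f β, hf β, hf' β, hx β hβ⟩

end Ladder

/-! ### Guessing clubs at successor points of ladders -/

section Guess

variable {X Y : Type v} [LinearOrder X] [WellFoundedLT X] [UncountableRegularOrder X]
  [LinearOrder Y] [WellFoundedLT Y] [UncountableRegularOrder Y]
  {S : Set X} {al : X → Y → X}

/-- If no `F` weakly guesses clubs, then a club and a system of clubs of `Y` can be refined so that
the gaps of the new club jump over the next point of the old system. -/
theorem exists_jump (hal : ∀ δ ∈ S, IsLadder δ (al δ))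
    (H : ∀ F : X → Y → X, (∀ δ ∈ S, ∀ ζ, F δ ζ < δ) → ∃ E, IsClub E ∧
      ∀ δ ∈ S, δ ∈ limitPoints E → ∀ᶠ ζ in clubFilter Y, ∀ e ∈ E, al δ ζ < e → F δ ζ < e)
    (p : {p : Set X × (X → Set Y) // IsClub p.1 ∧ ∀ δ, IsClub (p.2 δ)}) :
    ∃ q : {p : Set X × (X → Set Y) // IsClub p.1 ∧ ∀ δ, IsClub (p.2 δ)},
      q.1.1 ⊆ p.1.1 ∧ (∀ δ, q.1.2 δ ⊆ p.1.2 δ) ∧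
      ∀ δ ∈ S, δ ∈ limitPoints q.1.1 → ∀ ζ ∈ q.1.2 δ, ∃ ζ' ∈ p.1.2 δ,
        (∃ e ∈ p.1.1, al δ ζ < e ∧ e ≤ al δ ζ') ∧ ∀ e ∈ q.1.1, al δ ζ < e → al δ ζ' < e := by
  classical
  obtain ⟨⟨E, K⟩, hE, hK⟩ := p
  have hnext : ∀ δ ζ, ∃ ζ', δ ∈ S → δ ∈ limitPoints E →
      ζ' ∈ K δ ∧ ∃ e ∈ E, al δ ζ < e ∧ e ≤ al δ ζ' := by
    intro δ ζ
    by_cases h : δ ∈ S ∧ δ ∈ limitPoints E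
    · obtain ⟨e, he, h1, h2⟩ := h.2 _ ((hal δ h.1).lt ζ)
      obtain ⟨ξ, hξ⟩ := (hal δ h.1).cofinal e h2
      obtain ⟨ζ', h3, h4⟩ := (hK δ).isCofinal ξ
      exact ⟨ζ', fun _ _ => ⟨h3, e, he, h1,
        hξ.le.trans ((hal δ h.1).isNormal.strictMono.monotone h4)⟩⟩
    · exact ⟨ζ, fun h1 h2 => (h ⟨h1, h2⟩).elim⟩
  choose f hf using hnext
  -- The bound tested is a point of the old system lying past the next step into `E`; a club
  -- refuting it has no point in between.
  obtain ⟨E', hE', hkill⟩ := H (fun δ ζ => al δ (f δ ζ)) fun δ hδ ζ => (hal δ hδ).lt _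
  have hK' : ∀ δ, ∃ K', IsClub K' ∧ K' ⊆ K δ ∧ (δ ∈ S → δ ∈ limitPoints E' →
      ∀ ζ ∈ K', ∀ e ∈ E', al δ ζ < e → al δ (f δ ζ) < e) := by
    intro δ
    by_cases h : δ ∈ S ∧ δ ∈ limitPoints E'
    · obtain ⟨t, ht, h'⟩ := mem_clubFilter.1 (hkill δ h.1 h.2)
      exact ⟨t ∩ K δ, ht.inter UncountableRegularOrder.aleph0_lt_cof.ne' (hK δ),
        inter_subset_right, fun _ _ ζ hζ => h' hζ.1⟩
    · exact ⟨K δ, hK δ, subset_rfl, fun h1 h2 => (h ⟨h1, h2⟩).elim⟩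
  choose K' hK'c hK's hK' using hK'
  refine ⟨⟨(E ∩ E', K'), hE.inter UncountableRegularOrder.aleph0_lt_cof.ne' hE', hK'c⟩,
    inter_subset_left, hK's, fun δ hδ hlim ζ hζ => ?_⟩
  obtain ⟨h1, h2⟩ := hf δ ζ hδ (limitPoints_mono inter_subset_left hlim)
  exact ⟨f δ ζ, h1, h2, fun e he =>
    hK' δ hδ (limitPoints_mono inter_subset_right hlim) ζ hζ e he.2⟩

theorem exists_weak_guess (hS : IsStationary S) (hal : ∀ δ ∈ S, IsLadder δ (al δ)) :
    ∃ F : X → Y → X, (∀ δ ∈ S, ∀ ζ, F δ ζ < δ) ∧ ∀ E, IsClub E → ∃ δ ∈ S, δ ∈ limitPoints E ∧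
      ∃ᶠ ζ in clubFilter Y, ∃ e ∈ E, al δ ζ < e ∧ e ≤ F δ ζ := by
  by_contra hcon
  have H : ∀ F : X → Y → X, (∀ δ ∈ S, ∀ ζ, F δ ζ < δ) → ∃ E, IsClub E ∧
      ∀ δ ∈ S, δ ∈ limitPoints E →
        ∀ᶠ ζ in clubFilter Y, ∀ e ∈ E, al δ ζ < e → F δ ζ < e := by
    intro F hF
    by_contra hE
    refine hcon ⟨F, hF, fun E hEc => ?_⟩
    by_contra hδ
    refine hE ⟨E, hEc, fun δ hδS hδE => ?_⟩
    by_contra hζ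
    refine hδ ⟨δ, hδS, hδE, ?_⟩
    simpa only [not_eventually, not_forall, exists_prop, not_lt] using hζ
  choose nx hnE hnK hn using exists_jump hal H
  let s : ℕ → {p : Set X × (X → Set Y) // IsClub p.1 ∧ ∀ δ, IsClub (p.2 δ)} := fun n =>
    nx^[n] ⟨(univ, fun _ => univ), .univ, fun _ => .univ⟩
  have hs : ∀ n, s (n + 1) = nx (s n) := fun n => Function.iterate_succ_apply' _ _ _
  have hEanti : Antitone fun n => (s n).1.1 := antitone_nat_of_succ_le fun n => by
    simp only [hs]; exact hnE _
  have hKanti : ∀ δ, Antitone fun n => (s n).1.2 δ := fun δ => antitone_nat_of_succ_le fun n => by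
    simp only [hs]; exact hnK _ δ
  set E : Set X := ⋂ n, (s n).1.1 with hEdef
  set K : X → Set Y := fun δ => ⋂ n, (s n).1.2 δ with hKdef
  have hE : IsClub E := isClub_iInter_nat fun n => (s n).2.1
  have hK : ∀ δ, IsClub (K δ) := fun δ => isClub_iInter_nat fun n => (s n).2.2 δ
  have hEn : ∀ n, E ⊆ (s n).1.1 := fun n => iInter_subset _ n
  -- the successor of a point of `al δ '' K δ` in `E` is again such a point
  have hG : ∀ x : X, ∃ g, x < g ∧
      ∀ δ ∈ S, δ ∈ limitPoints E → x ∈ al δ '' K δ → g ∈ al δ '' K δ := by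
    intro x
    have hne : {e | e ∈ E ∧ x < e}.Nonempty := by
      obtain ⟨y, hy⟩ := exists_gt x
      obtain ⟨e, he, hye⟩ := hE.isCofinal y
      exact ⟨e, he, hy.trans_le hye⟩
    have hgm := WellFounded.min_mem (wellFounded_lt (α := X)) _ hne
    have hmin : ∀ e ∈ E, x < e → WellFounded.min (wellFounded_lt (α := X)) _ hne ≤ e :=
      fun e h1 h2 => not_lt.1 (WellFounded.not_lt_min wellFounded_lt _ (show e ∈ {e | e ∈ E ∧ x < e} from ⟨h1, h2⟩))
    refine ⟨_, hgm.2, ?_⟩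
    generalize WellFounded.min (wellFounded_lt (α := X)) _ hne = g at hgm hmin
    rintro δ hδ hlim ⟨ζ, hζ, rfl⟩
    have hstep : ∀ n, ∃ ζ' ∈ (s n).1.2 δ, (∃ e ∈ (s n).1.1, al δ ζ < e ∧ e ≤ al δ ζ') ∧
        ∀ e ∈ (s (n + 1)).1.1, al δ ζ < e → al δ ζ' < e := fun n => by
      have := hn (s n) δ hδ (limitPoints_mono (by rw [← hs]; exact hEn _) hlim) ζ
        (by rw [← hs]; exact mem_iInter.1 hζ (n + 1))
      rwa [← hs] at this
    choose z hzK hze hzlt using hstep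
    choose e heE hze hez using hze
    -- The sequences interleave: `e n ≤ al δ (z n) < e (n + 1)`. Their common limit lies in every
    -- club of both systems, and every point of `E` beyond `al δ ζ` is beyond all `al δ (z n)`; so
    -- the limit is the next point `g` of `E`.
    have hz : StrictMono z := strictMono_nat_of_lt_succ fun n =>
      (hal δ hδ).isNormal.strictMono.lt_iff_lt.1
        ((hzlt n _ (heE (n + 1)) (hze (n + 1))).trans_le (hez (n + 1)))
    obtain ⟨b, hb⟩ := exists_gt_seq z
    obtain ⟨ζ', hζ'⟩ := exists_isLUB (s := range z) ⟨b, by rintro _ ⟨n, rfl⟩; exact (hb n).le⟩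
    have hlub := (hal δ hδ).isNormal.map_isLUB hζ' (range_nonempty z)
    have htail : ∀ m, IsLUB (range fun n => z (n + m)) ζ' := fun m =>
      ⟨by rintro _ ⟨n, rfl⟩; exact hζ'.1 ⟨_, rfl⟩, fun c hc => hζ'.2 (by
        rintro _ ⟨n, rfl⟩
        exact (hz.monotone (Nat.le_add_right n m)).trans (hc ⟨n, rfl⟩))⟩
    have hζ'K : ζ' ∈ K δ := mem_iInter.2 fun m =>
      ((s m).2.2 δ).isLUB_mem (by
        rintro _ ⟨n, rfl⟩
        exact hKanti δ (Nat.le_add_left m n) (hzK _)) (range_nonempty _) (htail m)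
    have hζ'E : al δ ζ' ∈ E := mem_iInter.2 fun m => by
      refine mem_of_isLUB_of_interleaved (s m).2.1
        ((hal δ hδ).isNormal.map_isLUB (htail m) (range_nonempty _))
        ((range_nonempty _).image _) ?_
      rintro _ ⟨_, ⟨n, rfl⟩, rfl⟩
      refine ⟨e (n + 1 + m), hEanti (Nat.le_add_left m (n + 1)) (heE _), ?_, _,
        ⟨_, ⟨n + 1, rfl⟩, rfl⟩, hez _⟩
      have := hzlt (n + m) (e (n + m + 1)) (heE _) (hze _)
      rw [show n + 1 + m = n + m + 1 by omega]
      exact this.le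
    refine ⟨ζ', hζ'K, ?_⟩
    refine le_antisymm (hlub.2 ?_) (hmin _ hζ'E ?_)
    · rintro _ ⟨_, ⟨n, rfl⟩, rfl⟩
      exact (hzlt n g (hEn _ hgm.1) hgm.2).le
    · exact (hze 0).trans_le ((hez 0).trans (hlub.1 ⟨_, ⟨0, rfl⟩, rfl⟩))
  choose G hGlt hG using hG
  have hYne := nonempty_of_uncountable Y
  have hfreq : ∃ᶠ δ in clubFilter X, ∃ x < δ, δ ∈ S ∧ δ ∈ limitPoints E ∧ x ∈ al δ '' K δ := by
    refine ((isStationary_iff_frequently.1 hS).and_eventually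
      (limitPoints_mem_clubFilter hE)).mono fun δ hδ => ?_
    obtain ⟨ζ, hζ⟩ := (hK δ).nonempty
    exact ⟨al δ ζ, (hal δ hδ.1).lt ζ, hδ.1, hδ.2, ζ, hζ, rfl⟩
  obtain ⟨x, hx⟩ := frequently_fodor hfreq
  obtain ⟨δ, hδS, hδE, hδx⟩ := hx.exists
  obtain ⟨δ', ⟨hδ'S, hδ'E, hδ'x⟩, hlt⟩ := frequently_exists_gt hx δ
  -- If the supremum `t` of the common points is below `δ`, then `G t` is a larger common point. If
  -- it is `δ`, then `δ` lies on the ladder of `δ'`, and the fewer than `#Y` earlier points of that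
  -- ladder would be cofinal in `δ`.
  set Z := al δ '' K δ ∩ al δ' '' K δ' with hZ
  have hZδ : ∀ z ∈ Z, z < δ := by
    rintro z ⟨⟨ζ, -, rfl⟩, -⟩
    exact (hal δ hδS).lt ζ
  obtain ⟨t, ht⟩ := exists_isLUB (s := Z) ⟨δ, fun z hz => (hZδ z hz).le⟩
  have htδ : t ≤ δ := ht.2 fun z hz => (hZδ z hz).le
  have htδ' : t ∈ al δ' '' K δ' := (hal δ' hδ'S).mem_image_of_isLUB (hK δ') inter_subset_right
    ⟨x, hδx, hδ'x⟩ ht (htδ.trans_lt hlt)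
  obtain htδ | rfl := htδ.lt_or_eq
  · have hmem := (hal δ hδS).mem_image_of_isLUB (hK δ) inter_subset_left ⟨x, hδx, hδ'x⟩ ht htδ
    exact (ht.1 ⟨hG t δ hδS hδE hmem, hG t δ' hδ'S hδ'E htδ'⟩).not_gt (hGlt t)
  · obtain ⟨ζ, hζ, hζt⟩ := htδ'
    obtain ⟨ξ, hξ⟩ := (hal t hδS).exists_bound (mk_Iio_lt ζ) (fun i => al δ' i) fun i => by
      rw [← hζt]; exact (hal δ' hδ'S).isNormal.strictMono i.2
    obtain ⟨z, hz, hzlt⟩ := (lt_isLUB_iff ht).1 ((hal t hδS).lt ξ)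
    obtain ⟨i, hi, rfl⟩ := hz.2
    refine hzlt.not_gt (hξ ⟨i, ?_⟩)
    have := hZδ _ hz
    rw [← hζt] at this
    exact (hal δ' hδ'S).isNormal.strictMono.lt_iff_lt.1 this

/-- Replace the weak bound by the largest point of a club at or below it. If this fails for every
club, shrinking the club `ω` times makes that point drop strictly each time, for some fixed `δ` and
`ζ`. -/
theorem exists_guess (hS : IsStationary S) (hal : ∀ δ ∈ S, IsLadder δ (al δ)) :
    ∃ F : X → Y → X, (∀ δ ∈ S, ∀ ζ, F δ ζ < δ) ∧ ∀ E, IsClub E → ∃ δ ∈ S, δ ∈ limitPoints E ∧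
      ∃ᶠ ζ in clubFilter Y, al δ ζ < F δ ζ ∧ F δ ζ ∈ E := by
  obtain ⟨F, hF, hFE⟩ := exists_weak_guess hS hal
  by_contra hcon
  -- the largest element of the closure of `E` that is at most `x`
  have hdrop : ∀ (E : Set X) (x : X), ∃ y ≤ x, (IsClub E → (E ∩ Iic x).Nonempty → y ∈ E) ∧
      ∀ e ∈ E, e ≤ x → e ≤ y := by
    intro E x
    obtain ⟨y, hy⟩ := exists_isLUB (s := E ∩ Iic x) ⟨x, fun z hz => hz.2⟩
    exact ⟨y, hy.2 fun z hz => hz.2, fun hE hne => hE.isLUB_mem inter_subset_left hne hy,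
      fun e h1 h2 => hy.1 ⟨h1, h2⟩⟩
  choose dr hdr hdrE hdrmax using hdrop
  have H : ∀ E : {E : Set X // IsClub E}, ∃ E' : {E : Set X // IsClub E}, E'.1 ⊆ E.1 ∧
      ∀ δ ∈ S, δ ∈ limitPoints E'.1 → ∀ᶠ ζ in clubFilter Y,
        al δ ζ < dr E.1 (F δ ζ) → dr E.1 (F δ ζ) ∉ E'.1 := by
    intro E
    by_contra hE
    refine hcon ⟨fun δ ζ => dr E.1 (F δ ζ), fun δ hδ ζ => (hdr _ _).trans_lt (hF δ hδ ζ),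
      fun E' hE' => ?_⟩
    by_contra hδ
    refine hE ⟨⟨E.1 ∩ E', E.2.inter UncountableRegularOrder.aleph0_lt_cof.ne' hE'⟩,
      inter_subset_left, fun δ hδS hδE => ?_⟩
    by_contra hζ
    refine hδ ⟨δ, hδS, limitPoints_mono inter_subset_right hδE, ?_⟩
    simp only [not_eventually, Classical.not_imp, not_not] at hζ
    exact hζ.mono fun ζ h => ⟨h.1, h.2.2⟩
  choose nx hnE hn using H
  let s : ℕ → {E : Set X // IsClub E} := fun n => nx^[n] ⟨univ, .univ⟩
  have hs : ∀ n, s (n + 1) = nx (s n) := fun n => Function.iterate_succ_apply' _ _ _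
  have hEanti : Antitone fun n => (s n).1 := antitone_nat_of_succ_le fun n => by
    simp only [hs]; exact hnE _
  have hEn : ∀ n, (⋂ n, (s n).1) ⊆ (s n).1 := fun n => iInter_subset _ n
  obtain ⟨δ, hδS, hδE, hfreq⟩ := hFE _ (isClub_iInter_nat fun n => (s n).2)
  have hall := eventually_all_nat fun n =>
    hn (s n) δ hδS (limitPoints_mono (by rw [← hs]; exact hEn _) hδE)
  obtain ⟨ζ, ⟨e, heE, hlt, hle⟩, hζ⟩ := (hfreq.and_eventually hall).exists
  have hanti : ∀ n, dr (s (n + 1)).1 (F δ ζ) < dr (s n).1 (F δ ζ) := fun n => by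
    have hmem : dr (s (n + 1)).1 (F δ ζ) ∈ (s (n + 1)).1 :=
      hdrE _ _ (s (n + 1)).2 ⟨e, hEn _ heE, hle⟩
    refine lt_of_le_of_ne (hdrmax _ _ _ (hEanti n.le_succ hmem) (hdr _ _)) fun heq => ?_
    refine hζ n (hlt.trans_le (hdrmax _ _ _ (hEn _ heE) hle)) ?_
    rw [← hs, ← heq]
    exact hmem
  exact not_strictAnti_of_wellFoundedLT _ 
    (strictAnti_nat_of_succ_lt (f := fun n => dr (s n).1 (F δ ζ)) hanti)

end Guess

/-! ### Colouring the guesses -/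

section Colouring

/-- There is a family of `#Y` subsets of `Y` such that each stationary set is met in stationary sets
by `#J` pairwise disjoint members of the family. -/
def Splits (Y J : Type v) [LinearOrder Y] [WellFoundedLT Y] [UncountableRegularOrder Y] : Prop :=
  ∃ ι : Type v, #ι ≤ #Y ∧ ∃ U : ι → Set Y, ∀ p : Y → Prop, (∃ᶠ ζ in clubFilter Y, p ζ) →
    ∃ q : J → ι, (Pairwise fun i j => Disjoint (U (q i)) (U (q j))) ∧
      ∀ j, ∃ᶠ ζ in clubFilter Y, p ζ ∧ ζ ∈ U (q j)

variable {X Y J : Type v} [LinearOrder X] [WellFoundedLT X] [UncountableRegularOrder X]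
  [LinearOrder Y] [WellFoundedLT Y] [UncountableRegularOrder Y]
  {S : Set X} {al : X → Y → X}

theorem exists_colouring (hYX : #Y < #X) (hJ : #J < #Y) [Nonempty J] (hsplit : Splits Y J)
    {F : X → Y → X} (hF : ∀ E, IsClub E → ∃ δ ∈ S, δ ∈ limitPoints E ∧
      ∃ᶠ ζ in clubFilter Y, al δ ζ < F δ ζ ∧ F δ ζ ∈ E) :
    ∃ g : X → Y → J, ∀ E, IsClub E → ∃ δ ∈ S, δ ∈ limitPoints E ∧
      ∀ j, ∃ᶠ ζ in clubFilter Y, (al δ ζ < F δ ζ ∧ F δ ζ ∈ E) ∧ g δ ζ = j := by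
  classical
  obtain ⟨ι, hι, U, hU⟩ := hsplit
  obtain ⟨e⟩ := Cardinal.le_def _ _ |>.1 hι
  let P : X → Set X → ι → Prop := fun δ E i =>
    ∃ᶠ ζ in clubFilter Y, (al δ ζ < F δ ζ ∧ F δ ζ ∈ E) ∧ ζ ∈ U i
  have hPmono : ∀ δ i {E E'}, E ⊆ E' → P δ E i → P δ E' i := fun δ i E E' h hP =>
    hP.mono fun ζ hζ => ⟨⟨hζ.1.1, h hζ.1.2⟩, hζ.2⟩
  let good : (J → ι) → Prop := fun q => Pairwise fun i j => Disjoint (U (q i)) (U (q j))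
  have hlift : lift.{v} #Y < lift.{v} #X := by simpa using hYX
  -- Were every `b` refuted by a club, the intersection of these `#Y < #X` clubs would still be
  -- guessed, and the `#J < #Y` test sets splitting that guess would have bounded indices.
  obtain ⟨b, hb⟩ : ∃ b : Y, ∀ E, IsClub E → ∃ δ ∈ S, δ ∈ limitPoints E ∧
      ∃ q, good q ∧ ∀ j, e (q j) < b ∧ P δ E (q j) := by
    by_contra hcon
    push Not at hcon
    choose E hE hE' using hcon
    obtain ⟨δ, hδS, hδE, hfreq⟩ := hF (⋂ b, E b) (isClub_iInter_small hlift hE)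
    obtain ⟨q, hq, hqP⟩ := hU _ hfreq
    obtain ⟨b, hb⟩ := exists_gt_range hJ fun j => e (q j)
    obtain ⟨j, hj⟩ := hE' b δ hδS (limitPoints_mono (iInter_subset _ b) hδE) q hq
    exact hj (hb j) (hPmono δ (q j) (iInter_subset _ b) (hqP j))
  by_contra hcon
  have H : ∀ Q : X → J → ι, ∃ E, IsClub E ∧ ∀ δ ∈ S, δ ∈ limitPoints E → good (Q δ) →
      ∃ j, ¬ P δ E (Q δ j) := by
    intro Q
    by_contra hE
    push Not at hE
    -- The colour of `ζ` is the `j` whose test set contains it, unique by disjointness; outside all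
    -- of them the value is arbitrary.
    refine hcon ⟨fun δ ζ => if h : ∃ j, ζ ∈ U (Q δ j) then h.choose else Classical.arbitrary J,
      fun E hEc => ?_⟩
    obtain ⟨δ, hδS, hδE, hgood, hP⟩ := hE E hEc
    refine ⟨δ, hδS, hδE, fun j => (hP j).mono fun ζ hζ => ⟨hζ.1, ?_⟩⟩
    have h : ∃ j, ζ ∈ U (Q δ j) := ⟨j, hζ.2⟩
    simp only [dif_pos h]
    by_contra hne
    exact (hgood hne).le_bot ⟨h.choose_spec, hζ.2⟩
  have hnx : ∀ E : {E : Set X // IsClub E}, ∃ E' : {E : Set X // IsClub E},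
      ∀ δ ∈ S, δ ∈ limitPoints E'.1 → (∃ q, good q ∧ ∀ j, e (q j) < b ∧ P δ E.1 (q j)) →
        ∃ i, e i < b ∧ P δ E.1 i ∧ ¬ P δ E'.1 i := by
    intro E
    have hQ : ∀ δ, ∃ q, (∃ q, good q ∧ ∀ j, e (q j) < b ∧ P δ E.1 (q j)) →
        good q ∧ ∀ j, e (q j) < b ∧ P δ E.1 (q j) := by
      intro δ
      by_cases h : ∃ q, good q ∧ ∀ j, e (q j) < b ∧ P δ E.1 (q j)
      · exact ⟨h.choose, fun _ => h.choose_spec⟩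
      · exact ⟨(hU (fun _ => True)
          (Eventually.of_forall fun _ => trivial).frequently).choose, fun h' => (h h').elim⟩
    choose Q hQ using hQ
    obtain ⟨E', hE', hkill⟩ := H Q
    refine ⟨⟨E', hE'⟩, fun δ hδS hδE h => ?_⟩
    obtain ⟨j, hj⟩ := hkill δ hδS hδE (hQ δ h).1
    exact ⟨Q δ j, ((hQ δ h).2 j).1, ((hQ δ h).2 j).2, hj⟩
  choose nx hnx using hnx
  have hclub : ∀ (ξ : Y) (f : (η : Y) → η < ξ → {E : Set X // IsClub E}),
      IsClub (⋂ η : Iio ξ, (f η η.2).1) := fun ξ f =>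
    isClub_iInter_small (by simpa using (mk_Iio_lt ξ).trans hYX) fun η => (f η η.2).2
  -- At each of `#Y` stages, the intersection of the earlier clubs is refined so that, at every
  -- relevant `δ`, some index below `b` stops working.
  let s : Y → {E : Set X // IsClub E} := wellFounded_lt.fix fun ξ f => nx ⟨_, hclub ξ f⟩
  have hs : ∀ ξ, s ξ = nx ⟨_, hclub ξ fun η _ => s η⟩ := fun ξ => wellFounded_lt.fix_eq _ ξ
  obtain ⟨δ, hδS, hδE, q, hq, hqP⟩ := hb (⋂ ξ, (s ξ).1)
    (isClub_iInter_small hlift fun ξ => (s ξ).2)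
  have hex : ∀ ξ, ∃ i, e i < b ∧ (∀ η < ξ, P δ (s η).1 i) ∧ ¬ P δ (s ξ).1 i := by
    intro ξ
    obtain ⟨i, h1, h2, h3⟩ := hnx ⟨_, hclub ξ fun η _ => s η⟩ δ hδS
      (limitPoints_mono (by rw [← hs]; exact iInter_subset _ ξ) hδE)
      ⟨q, hq, fun j => ⟨(hqP j).1, hPmono δ _ (fun x hx => mem_iInter.2 fun η =>
        mem_iInter.1 hx η.1) (hqP j).2⟩⟩
    refine ⟨i, h1, fun η hη => hPmono δ i (iInter_subset (fun η : Iio ξ => (s η).1) ⟨η, hη⟩) h2, ?_⟩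
    rwa [hs]
  choose i hib hiP hiN using hex
  -- The index lost at stage `ξ` still worked at all earlier stages, so different stages lose
  -- different indices.
  have hinj : Function.Injective fun ξ => (⟨e (i ξ), hib ξ⟩ : Iio b) := by
    intro ξ η h
    have h : i ξ = i η := e.injective (congrArg Subtype.val h)
    obtain hlt | heq | hlt := lt_trichotomy ξ η
    · exact (hiN ξ (h ▸ hiP η ξ hlt)).elim
    · exact heq
    · exact (hiN η (h ▸ hiP ξ η hlt)).elim
  exact (mk_le_of_injective hinj).not_gt (mk_Iio_lt b)

end Colouring

/-! ### Splitting stationary subsets of `Y` -/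

section Splitting

variable {Y J : Type v} [LinearOrder Y] [WellFoundedLT Y] [UncountableRegularOrder Y]

/-- The variant of `Splits` for stationary sets of points satisfying `r`. -/
def SplitsOn (r : Y → Prop) (J : Type v) : Prop :=
  ∃ ι : Type v, #ι ≤ #Y ∧ ∃ U : ι → Set Y, ∀ p : Y → Prop, (∃ᶠ ζ in clubFilter Y, p ζ ∧ r ζ) →
    ∃ q : J → ι, (Pairwise fun i j => Disjoint (U (q i)) (U (q j))) ∧
      ∀ j, ∃ᶠ ζ in clubFilter Y, p ζ ∧ ζ ∈ U (q j)

theorem SplitsOn.splits {r : Y → Prop} (h : SplitsOn r J) (hr : ∀ᶠ ζ in clubFilter Y, r ζ) :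
    Splits Y J := by
  obtain ⟨ι, hι, U, hU⟩ := h
  exact ⟨ι, hι, U, fun p hp => hU p (hp.and_eventually hr)⟩

theorem SplitsOn.or {r r' : Y → Prop} (h : SplitsOn r J) (h' : SplitsOn r' J) :
    SplitsOn (fun ζ => r ζ ∨ r' ζ) J := by
  obtain ⟨ι, hι, U, hU⟩ := h
  obtain ⟨ι', hι', U', hU'⟩ := h'
  refine ⟨ι ⊕ ι', ?_, Sum.elim U U', fun p hp => ?_⟩
  · rw [mk_sum, lift_id, lift_id]
    exact add_le_of_le (aleph0_lt_mk Y).le hι hι'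
  · have : ∃ᶠ ζ in clubFilter Y, (p ζ ∧ r ζ) ∨ (p ζ ∧ r' ζ) := hp.mono fun ζ h => by tauto
    rw [frequently_or_distrib] at this
    obtain h | h := this
    · obtain ⟨q, h1, h2⟩ := hU p h
      exact ⟨Sum.inl ∘ q, h1, h2⟩
    · obtain ⟨q, h1, h2⟩ := hU' p h
      exact ⟨Sum.inr ∘ q, h1, h2⟩

theorem frequently_two {p : Y → Prop} (h : ∃ᶠ ζ in clubFilter Y, p ζ) :
    ∃ ζ ζ', p ζ ∧ p ζ' ∧ ζ < ζ' := by
  obtain ⟨ζ, hζ⟩ := h.exists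
  obtain ⟨ζ', hζ', hlt⟩ := frequently_exists_gt h ζ
  exact ⟨ζ, ζ', hζ, hζ', hlt⟩

theorem mk_setOf_frequently {p : Y → Prop} (h : ∃ᶠ ζ in clubFilter Y, p ζ) :
    #{ζ | p ζ} = #Y :=
  mk_eq_of_unbounded fun b => frequently_exists_gt h b

/-! ### Points of smaller cofinality -/

/-- The cofinality of `ζ` is smaller than `ζ`, as witnessed by `θ` and the sequence `c`. -/
def IsSingularAt (ζ θ : Y) (c : Y → Y) : Prop :=
  θ < ζ ∧ (∀ i < θ, c i < ζ) ∧ ∀ y < ζ, ∃ i < θ, y ≤ c i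

theorem exists_isSingularAt {ζ θ : Y} (hθ : θ < ζ) (h : Order.cof (Iio ζ) ≤ #(Iio θ)) :
    ∃ c, IsSingularAt ζ θ c := by
  classical
  obtain ⟨s, hs, hs'⟩ := Order.exists_cof_eq (Iio ζ)
  rw [← hs'] at h
  obtain ⟨e⟩ := Cardinal.le_def _ _ |>.1 h
  refine ⟨fun i => if h : ∃ x : s, (e x).1 = i then h.choose.1.1 else θ, hθ, fun i _ => ?_,
    fun y hy => ?_⟩
  · dsimp only
    split_ifs with h
    · exact h.choose.1.2
    · exact hθ
  · obtain ⟨x, hx, hyx⟩ := hs ⟨y, hy⟩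
    refine ⟨(e ⟨x, hx⟩).1, (e ⟨x, hx⟩).2, ?_⟩
    have h : ∃ x' : s, (e x').1 = (e ⟨x, hx⟩).1 := ⟨_, rfl⟩
    have heq : h.choose = ⟨x, hx⟩ := e.injective (Subtype.ext h.choose_spec)
    simp only [dif_pos h, heq]
    exact hyx

/-- Solovay's splitting argument. -/
theorem frequently_solovay {p : Y → Prop} {θ : Y → Y} {c : Y → Y → Y}
    (h : ∃ᶠ ζ in clubFilter Y, p ζ) (hc : ∀ ζ, p ζ → IsSingularAt ζ (θ ζ) (c ζ)) :
    ∃ θ₀ i, ∀ b, ∃ ξ, b < ξ ∧ ∃ᶠ ζ in clubFilter Y, p ζ ∧ θ ζ = θ₀ ∧ c ζ i = ξ := by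
  obtain ⟨θ₀, hθ₀⟩ := frequently_fodor (p := fun a ζ => p ζ ∧ θ ζ = a)
    (h.mono fun ζ hζ => ⟨θ ζ, (hc ζ hζ).1, hζ, rfl⟩)
  refine ⟨θ₀, ?_⟩
  by_contra hcon
  push Not at hcon
  choose b hb using hcon
  -- If for each `i < θ₀` the values of `c ζ i` taken stationarily often are bounded, a single `β`
  -- bounds them all. By Fodor almost every relevant sequence stays at or below `β`, so it is not
  -- cofinal in a `ζ` above `β'`.
  obtain ⟨β, hβ⟩ := exists_gt_range (mk_Iio_lt θ₀) fun i => b i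
  obtain ⟨β', hβ'⟩ := exists_gt β
  have hall : ∀ᶠ ζ in clubFilter Y, ∀ i : Iio θ₀, ¬ (p ζ ∧ θ ζ = θ₀ ∧ β < c ζ i) := by
    refine eventually_all_small (by simpa using mk_Iio_lt θ₀) fun i => not_frequently.1 fun hf => ?_
    obtain ⟨ξ, hξ⟩ := frequently_fodor (p := fun a ζ => (p ζ ∧ θ ζ = θ₀ ∧ β < c ζ i) ∧ c ζ i = a)
      (hf.mono fun ζ hζ => ⟨c ζ i, (hc ζ hζ.1).2.1 i (by rw [hζ.2.1]; exact i.2), hζ, rfl⟩)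
    obtain ⟨ζ, hζ⟩ := hξ.exists
    exact hξ ((hb i ξ ((hβ i).trans (hζ.2 ▸ hζ.1.2.2))).mono fun ζ h h' =>
      h h'.1.1 h'.1.2.1 h'.2)
  obtain ⟨ζ, ⟨hp, hθ⟩, hζ, hlt⟩ :=
    (hθ₀.and_eventually (hall.and (eventually_clubFilter_gt β'))).exists
  obtain ⟨i, hi, hle⟩ := (hc ζ hp).2.2 β' hlt
  exact hζ ⟨i, hθ ▸ hi⟩ ⟨hp, hθ, hβ'.trans_le hle⟩

/-- The test sets fix the length of the witnessing sequence and one of its values. Solovay's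
argument provides a coordinate with `#Y` stationary values, and different values give disjoint sets.
-/
theorem splitsOn_isSingularAt (hJ : #J ≤ #Y) :
    SplitsOn (fun ζ : Y => ∃ θ c, IsSingularAt ζ θ c) J := by
  classical
  have hex : ∀ ζ : Y, ∃ θ c, (∃ θ c, IsSingularAt ζ θ c) → IsSingularAt ζ θ c := fun ζ => by
    by_cases h : ∃ θ c, IsSingularAt ζ θ c
    · obtain ⟨θ, c, h'⟩ := h
      exact ⟨θ, c, fun _ => h'⟩
    · exact ⟨ζ, fun _ => ζ, fun h' => (h h').elim⟩
  choose θ c hc using hex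
  refine ⟨Y × Y × Y, ?_, fun x => {ζ | θ ζ = x.1 ∧ c ζ x.2.1 = x.2.2}, fun p hp => ?_⟩
  · simp only [mk_prod, lift_id]
    rw [mul_eq_self (aleph0_lt_mk Y).le, mul_eq_self (aleph0_lt_mk Y).le]
  · obtain ⟨θ₀, i, hi⟩ := frequently_solovay hp fun ζ hζ => hc ζ hζ.2
    have hW : #{ξ | ∃ᶠ ζ in clubFilter Y, (p ζ ∧ ∃ θ c, IsSingularAt ζ θ c) ∧ θ ζ = θ₀ ∧
        c ζ i = ξ} = #Y := mk_eq_of_unbounded fun b => by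
      obtain ⟨ξ, h1, h2⟩ := hi b
      exact ⟨ξ, h2, h1⟩
    rw [← hW] at hJ
    obtain ⟨e⟩ := Cardinal.le_def _ _ |>.1 hJ
    refine ⟨fun j => (θ₀, i, (e j).1), fun j j' hjj' => ?_, fun j => ?_⟩
    · refine Set.disjoint_left.2 fun ζ h h' => hjj' (e.injective (Subtype.ext ?_))
      exact h.2.symm.trans h'.2
    · exact (e j).2.mono fun ζ hζ => ⟨hζ.1.1, hζ.2.1, hζ.2.2⟩

/-! ### Trees -/

theorem isBranch_isLowerSet {T : Type u} [PartialOrder T] (hT : IsTree T) {η : Set T}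
    (hη : IsBranch η) : IsLowerSet η := by
  intro y x hxy hy
  have hch : IsChain (· ≤ ·) (insert x η) := by
    refine hη.1.insert fun z hz hne => ?_
    obtain h | h := hη.1.total hy hz
    · exact Or.inl (hxy.trans h)
    · obtain rfl | hxy := hxy.eq_or_lt
      · exact Or.inr h
      obtain rfl | h := h.eq_or_lt
      · exact Or.inl hxy.le
      have := hT y
      obtain h1 | h1 | h1 := trichotomous_of (α := Iio y) (· < ·) ⟨x, hxy⟩ ⟨z, h⟩
      · exact Or.inl (le_of_lt h1)
      · exact (hne (congrArg Subtype.val h1)).elim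
      · exact Or.inr (le_of_lt h1)
  rw [hη.2 hch (subset_insert x η)]
  exact mem_insert x η

/-- Fewer than `#Y` nodes means that, off a nonstationary set, all nodes of a branch `η ζ` with `p
ζ` lie on stationarily many such branches. So the subtree `T'` of these nodes contains `#Y` branches
and has a large antichain; incomparable nodes lie on no common branch. -/
theorem splits_of_tree {T : Type u} [PartialOrder T] (hT : IsTree T)
    (hTY : lift.{v} #T < lift.{u} #Y) (η : Y → Set T) (hη : ∀ ζ, IsBranch (η ζ))
    (hanti : ∀ T' : Set T, IsLowerSet T' → #{ζ | η ζ ⊆ T'} = #Y →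
      ∃ A ⊆ T', IsAntichain (· ≤ ·) A ∧ lift.{u} #J ≤ lift.{v} #A) : Splits Y J := by
  have hTY' : #(ULift.{v} T) < #(ULift.{u} Y) := by simpa using hTY
  obtain ⟨e⟩ := Cardinal.lift_mk_le'.1 hTY.le
  refine ⟨Y, le_rfl, fun y => {ζ | ∃ t ∈ η ζ, e t = y}, fun p hp => ?_⟩
  set T' : Set T := {t | ∃ᶠ ζ in clubFilter Y, p ζ ∧ t ∈ η ζ} with hT'
  have hlow : IsLowerSet T' := fun y x hxy hy => hy.mono fun ζ hζ =>
    ⟨hζ.1, isBranch_isLowerSet hT (hη ζ) hxy hζ.2⟩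
  have hev : ∀ᶠ ζ in clubFilter Y, p ζ → η ζ ⊆ T' := by
    have := eventually_all_small (α := Y) (p := fun (t : T) ζ => p ζ ∧ t ∈ η ζ → t ∈ T') hTY
      fun t => by
        by_cases h : t ∈ T'
        · exact Eventually.of_forall fun _ _ => h
        · exact (not_frequently.1 h).mono fun ζ hζ hζ' => (hζ hζ').elim
    exact this.mono fun ζ hζ hp t ht => hζ t ⟨hp, ht⟩
  obtain ⟨A, hA, hAa, hJ⟩ := hanti T' hlow
    (mk_setOf_frequently ((hp.and_eventually hev).mono fun ζ hζ => hζ.2 hζ.1))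
  obtain ⟨f⟩ := Cardinal.lift_mk_le'.1 hJ
  refine ⟨fun j => e (f j).1, fun i j hij => Set.disjoint_left.2 ?_, fun j => ?_⟩
  · rintro ζ ⟨t, ht, hte⟩ ⟨t', ht', hte'⟩
    obtain rfl := e.injective hte
    obtain rfl := e.injective hte'
    have hne : (f i).1 ≠ (f j).1 := fun h => hij (f.injective (Subtype.ext h))
    obtain h | h := (hη ζ).1.total ht ht'
    · exact hAa (f i).2 (f j).2 hne h
    · exact hAa (f j).2 (f i).2 hne.symm h
  · exact (hA (f j).2).mono fun ζ hζ => ⟨hζ.1, _, hζ.2, rfl⟩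

/-! ### Failure of ineffability -/

theorem isRegular_mk (Y : Type v) [LinearOrder Y] [WellFoundedLT Y] [UncountableRegularOrder Y] :
    (#Y).IsRegular := by
  refine ⟨(aleph0_lt_mk Y).le, ?_⟩
  rw [Cardinal.ord_cardinalMk, Ordinal.cof_type, Order.cof_eq_cardinalMk]

/-- The test sets fix a trace of `A ζ` on some `a`. If one level has `#J` traces occurring
stationarily often, these split. Otherwise the tree of such traces is so narrow that splitting stops
above some level, and the remaining branches cohere into a set `B` contradicting `hA`. -/
theorem splitsOn_of_not_ineffable (hstrong : ∀ x < #Y, 2 ^ x < #Y) (hJ : #J < #Y) {r : Y → Prop}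
    {A : Y → Set Y}
    (hA : ∀ B : Set Y, ¬ ∃ᶠ ζ in clubFilter Y, r ζ ∧ ∀ ξ < ζ, ξ ∈ A ζ ↔ ξ ∈ B) :
    SplitsOn r J := by
  classical
  have hset : ∀ a : Y, #(Set (Iio a)) < #Y := fun a => by
    rw [mk_set]; exact hstrong _ (mk_Iio_lt a)
  let tr : (ζ a : Y) → Set (Iio a) := fun ζ a => {i | i.1 ∈ A ζ}
  have htr : ∀ ζ ζ' a, tr ζ a = tr ζ' a ↔ ∀ ξ < a, ξ ∈ A ζ ↔ ξ ∈ A ζ' := by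
    intro ζ ζ' a
    constructor
    · intro h ξ hξ
      exact Set.ext_iff.1 h ⟨ξ, hξ⟩
    · intro h
      exact Set.ext fun i => h i i.2
  refine ⟨Σ a : Y, Set (Iio a), ?_, fun n => {ζ | tr ζ n.1 = n.2}, fun p hp => ?_⟩
  · rw [mk_sigma]
    refine (Cardinal.sum_le_sum _ (fun _ => #Y) fun a => (hset a).le).trans ?_
    rw [Cardinal.sum_const, lift_id, mul_eq_self (aleph0_lt_mk Y).le]
  let large : (a : Y) → Set (Set (Iio a)) := fun a => {s | ∃ᶠ ζ in clubFilter Y, p ζ ∧ tr ζ a = s}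
  by_cases hwide : ∃ a, #J ≤ #(large a)
  · obtain ⟨a, ha⟩ := hwide
    obtain ⟨e⟩ := Cardinal.le_def _ _ |>.1 ha
    refine ⟨fun j => ⟨a, (e j).1⟩, fun i j hij => Set.disjoint_left.2 fun ζ h h' => ?_,
      fun j => (e j).2⟩
    exact hij (e.injective (Subtype.ext (h.symm.trans h')))
  exfalso
  push Not at hwide
  have hlarge : ∀ᶠ ζ in clubFilter Y, p ζ → ∀ a < ζ, tr ζ a ∈ large a := by
    have : ∀ᶠ ζ in clubFilter Y, ∀ a < ζ, p ζ → tr ζ a ∈ large a := by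
      refine eventually_diag fun a => ?_
      have := eventually_all_small (α := Y)
        (p := fun (s : Set (Iio a)) ζ => p ζ ∧ tr ζ a = s → s ∈ large a) (by simpa using hset a)
        fun s => by
          by_cases h : s ∈ large a
          · exact Eventually.of_forall fun _ _ => h
          · exact (not_frequently.1 h).mono fun ζ hζ hζ' => (hζ hζ').elim
      exact this.mono fun ζ hζ hp => hζ _ ⟨hp, rfl⟩
    exact this.mono fun ζ hζ hp a ha => hζ a ha hp
  set p' : Y → Prop := fun ζ => p ζ ∧ r ζ ∧ ∀ a < ζ, tr ζ a ∈ large a with hp'def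
  have hp' : ∃ᶠ ζ in clubFilter Y, p' ζ :=
    (hp.and_eventually hlarge).mono fun ζ hζ => ⟨hζ.1.1, hζ.1.2, hζ.2 hζ.1.1⟩
  -- the levels at which the tree of large nodes splits
  let L : Set Y := {b | ∀ a, ∃ ζ ζ', a < ζ ∧ a < ζ' ∧ p' ζ ∧ p' ζ' ∧ tr ζ b = tr ζ' b ∧
    ¬ (b ∈ A ζ ↔ b ∈ A ζ')}
  by_cases hL : ∀ b, ∃ x ∈ L, b < x
  · have hLY := mk_eq_of_unbounded hL
    set μ := max #J ℵ₀ with hμ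
    have hμY : μ < #Y := max_lt hJ (aleph0_lt_mk Y)
    obtain ⟨s, hsL, hs⟩ := (Cardinal.le_mk_iff_exists_subset (s := L)).1 (hLY ▸ hμY.le)
    obtain ⟨a, ha⟩ := exists_gt_of_mk_lt (s := s) (hs ▸ hμY)
    have hex : ∀ b : s, ∃ ζ ζ', a < ζ ∧ a < ζ' ∧ p' ζ ∧ p' ζ' ∧ tr ζ b = tr ζ' b ∧
      ¬ (b.1 ∈ A ζ ↔ b.1 ∈ A ζ') := fun b => hsL b.2 a
    choose z z' hz hz' hpz hpz' heq hne using hex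
    -- A pair of traces on `a` determines the place of its first difference, so the `μ` splitting
    -- levels below `a` inject into pairs of large traces; but there are fewer than `μ` such pairs.
    have hinj : Function.Injective fun b : s =>
        ((⟨tr (z b) a, (hpz b).2.2 a (hz b)⟩, ⟨tr (z' b) a, (hpz' b).2.2 a (hz' b)⟩) :
          large a × large a) := by
      have key : ∀ b b' : s, tr (z b) a = tr (z b') a → tr (z' b) a = tr (z' b') a →
          ¬ b.1 < b'.1 := by
        intro b b' h1 h2 hlt
        rw [htr] at h1 h2
        refine hne b ?_
        rw [h1 b (ha b b.2), h2 b (ha b b.2)]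
        exact (htr _ _ _).1 (heq b') b hlt
      intro b b' h
      simp only [Prod.mk.injEq, Subtype.mk.injEq] at h
      obtain hlt | hlt | hlt := lt_trichotomy b.1 b'.1
      · exact (key b b' h.1 h.2 hlt).elim
      · exact Subtype.ext hlt
      · exact (key b' b h.1.symm h.2.symm hlt).elim
    have h1 := mk_le_of_injective hinj
    rw [hs, mk_prod, lift_id] at h1
    have h2 : #(large a) * #(large a) < μ := by
      obtain hfin | hinf := lt_or_ge #(large a) ℵ₀
      · exact (mul_lt_aleph0 hfin hfin).trans_le (le_max_right _ _)
      · rw [mul_eq_self hinf]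
        exact (hwide a).trans_le (le_max_left _ _)
    exact h1.not_gt h2
  · push Not at hL
    obtain ⟨b₀, hb₀⟩ := hL
    -- Above `b₀`, for all late `ζ`, the trace on `b` decides whether `b ∈ A ζ`. Fixing the trace on
    -- `b₁` and taking `ζ` closed under the thresholds `g` makes the sets cohere by induction.
    have hstable : ∀ b, ∃ a, b₀ < b → ∀ ζ ζ', a < ζ → a < ζ' → p' ζ → p' ζ' → tr ζ b = tr ζ' b →
        (b ∈ A ζ ↔ b ∈ A ζ') := by
      intro b
      by_cases hb : b₀ < b
      · have hbL : b ∉ L := fun h => (hb₀ b h).not_gt hb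
        simp only [L, Set.mem_ofPred_eq, not_forall, not_exists, not_and, not_not] at hbL
        obtain ⟨a, ha⟩ := hbL
        exact ⟨a, fun _ => ha⟩
      · exact ⟨b, fun h => (hb h).elim⟩
    choose g hg using hstable
    obtain ⟨b₁, hb₁⟩ := exists_gt b₀
    obtain ⟨s, hs⟩ := frequently_exists_small (α := Y) (ι := Set (Iio b₁))
      (p := fun s ζ => p' ζ ∧ tr ζ b₁ = s) (by simpa using hset b₁)
      (hp'.mono fun ζ hζ => ⟨_, hζ, rfl⟩)
    have hfin := hs.and_eventually (eventually_closed g)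
    have hcoh : ∀ ζ ζ', ((p' ζ ∧ tr ζ b₁ = s) ∧ ∀ a < ζ, g a < ζ) →
        ((p' ζ' ∧ tr ζ' b₁ = s) ∧ ∀ a < ζ', g a < ζ') → ∀ ξ < ζ, ξ < ζ' →
          (ξ ∈ A ζ ↔ ξ ∈ A ζ') := by
      intro ζ ζ' h h' ξ
      induction ξ using WellFoundedLT.induction with
      | ind ξ ih =>
      intro hξ hξ'
      by_cases hb : b₀ < ξ
      · exact hg ξ hb ζ ζ' (h.2 ξ hξ) (h'.2 ξ hξ') h.1.1 h'.1.1
          ((htr _ _ _).2 fun η hη => ih η hη (hη.trans hξ) (hη.trans hξ'))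
      · exact (htr _ _ _).1 (h.1.2.trans h'.1.2.symm) ξ ((not_lt.1 hb).trans_lt hb₁)
    refine hA {ξ | ∃ ζ, ((p' ζ ∧ tr ζ b₁ = s) ∧ ∀ a < ζ, g a < ζ) ∧ ξ < ζ ∧ ξ ∈ A ζ} ?_
    refine hfin.mono fun ζ hζ => ⟨hζ.1.1.2.1, fun ξ hξ => ⟨fun h => ⟨ζ, hζ, hξ, h⟩, ?_⟩⟩
    rintro ⟨ζ', hζ', hlt, hmem⟩
    exact (hcoh ζ ζ' hζ hζ' ξ hξ hlt).2 hmem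

end Splitting

/-! ### Antichains in trees of functions -/

section FunctionTree

variable {Y Θ W J J' : Type v} [LinearOrder Y] [WellFoundedLT Y] [UncountableRegularOrder Y]
  [LinearOrder Θ]

/-- The nodes of the tree of functions from initial segments of `Θ` to `W`. -/
abbrev Node (Θ W : Type v) [LinearOrder Θ] : Type v := Σ a : Θ, (Iic a → W)

/-- The restriction of a function to the elements up to `a`. -/
def Node.restrict (g : Θ → W) (a : Θ) : Node Θ W := ⟨a, fun i => g i⟩

/-- The indices of the functions extending the node `n`. -/
def cone (f : Y → Θ → W) (n : Node Θ W) : Set Y := {ζ | ∀ i : Iic n.1, f ζ i = n.2 i}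

theorem mem_cone_restrict {f : Y → Θ → W} {ζ : Y} {g : Θ → W} {a : Θ} :
    ζ ∈ cone f (Node.restrict g a) ↔ ∀ i ≤ a, f ζ i = g i :=
  ⟨fun h i hi => h ⟨i, hi⟩, fun h i => h i i.2⟩

theorem restrict_eq_iff {g g' : Θ → W} {a : Θ} :
    Node.restrict g a = Node.restrict g' a ↔ ∀ i ≤ a, g i = g' i := by
  simp only [Node.restrict, Sigma.mk.injEq, true_and, heq_eq_eq, funext_iff]
  exact ⟨fun h i hi => h ⟨i, hi⟩, fun h i => h i i.2⟩

theorem cone_subset_or {f : Y → Θ → W} {n m : Node Θ W} {ζ : Y} (hn : ζ ∈ cone f n)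
    (hm : ζ ∈ cone f m) : cone f n ⊆ cone f m ∨ cone f m ⊆ cone f n := by
  obtain h | h := le_total n.1 m.1
  · refine Or.inr fun ζ' h' i => ?_
    have hi : i.1 ≤ m.1 := i.2.trans h
    rw [← hn i, h' ⟨i, hi⟩, hm ⟨i, hi⟩]
  · refine Or.inl fun ζ' h' i => ?_
    have hi : i.1 ≤ n.1 := i.2.trans h
    rw [← hm i, h' ⟨i, hi⟩, hn ⟨i, hi⟩]

/-- There are pairwise incompatible nodes, indexed by `J`, each of which lies on stationarily many
of the branches `f ζ` with `p ζ`. -/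
def HasLargeAntichain (f : Y → Θ → W) (p : Y → Prop) (J : Type v) : Prop :=
  ∃ q : J → Node Θ W, (Pairwise fun i j => Disjoint (cone f (q i)) (cone f (q j))) ∧
    ∀ j, ∃ᶠ ζ in clubFilter Y, p ζ ∧ ζ ∈ cone f (q j)

theorem HasLargeAntichain.mono {f : Y → Θ → W} {p p' : Y → Prop} (hp : ∀ ζ, p ζ → p' ζ)
    (hJ : #J' ≤ #J) (h : HasLargeAntichain f p J) : HasLargeAntichain f p' J' := by
  obtain ⟨q, hq, hqp⟩ := h
  obtain ⟨e⟩ := Cardinal.le_def _ _ |>.1 hJ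
  exact ⟨q ∘ e, fun i j hij => hq (e.injective.ne hij),
    fun j => (hqp (e j)).mono fun ζ hζ => ⟨hp ζ hζ.1, hζ.2⟩⟩

/-- A set of pairwise incompatible nodes gives a large antichain. -/
theorem hasLargeAntichain_of_set {f : Y → Θ → W} {p : Y → Prop} {N : Set (Node Θ W)}
    (hN : N.PairwiseDisjoint (cone f)) (h : ∀ n ∈ N, ∃ᶠ ζ in clubFilter Y, p ζ ∧ ζ ∈ cone f n)
    (hJ : #J ≤ #N) : HasLargeAntichain f p J := by
  have : HasLargeAntichain f p N := ⟨Subtype.val, fun i j hij =>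
    hN i.2 j.2 fun h => hij (Subtype.ext h), fun j => h j j.2⟩
  exact this.mono (fun _ h => h) hJ

theorem frequently_large {f : Y → Θ → W} (hT : #(Node Θ W) < #Y) {p : Y → Prop}
    (hp : ∃ᶠ ζ in clubFilter Y, p ζ) :
    ∃ᶠ ζ in clubFilter Y, p ζ ∧ ∀ a, ∃ᶠ ξ in clubFilter Y, p ξ ∧
      ξ ∈ cone f (Node.restrict (f ζ) a) := by
  have := eventually_all_small (α := Y) (p := fun (n : Node Θ W) ζ => p ζ ∧ ζ ∈ cone f n →
    ∃ᶠ ξ in clubFilter Y, p ξ ∧ ξ ∈ cone f n) (by simpa using hT) fun n => by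
      by_cases h : ∃ᶠ ξ in clubFilter Y, p ξ ∧ ξ ∈ cone f n
      · exact Eventually.of_forall fun _ _ => h
      · exact (not_frequently.1 h).mono fun ζ hζ hζ' => (hζ hζ').elim
  exact (hp.and_eventually this).mono fun ζ hζ => ⟨hζ.1, fun a =>
    hζ.2 _ ⟨hζ.1, mem_cone_restrict.2 fun _ _ => rfl⟩⟩

variable [WellFoundedLT Θ]

theorem exists_first_difference {g g' : Θ → W} (h : g ≠ g') :
    ∃ a, g a ≠ g' a ∧ ∀ b < a, g b = g' b := by
  have hne : {a | g a ≠ g' a}.Nonempty := by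
    by_contra hc
    exact h (funext fun a => by_contra fun ha => hc ⟨a, ha⟩)
  refine ⟨WellFounded.min wellFounded_lt _ hne,
    WellFounded.min_mem (wellFounded_lt (α := Θ)) _ hne, fun b hb => by_contra fun hc => ?_⟩
  have hb' : b ∈ {a | g a ≠ g' a} := hc
  exact WellFounded.not_lt_min wellFounded_lt _ hb' hb

/-- If `#Θ` levels carry a branch splitting off one fixed branch, the nodes just after the
splittings are pairwise incompatible. Otherwise each branch is determined by its node at a level
bounding its splittings, and there are fewer nodes than branches. -/
theorem hasLargeAntichain_of_regular {f : Y → Θ → W} (hf : Function.Injective f)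
    (hT : #(Node Θ W) < #Y) (hΘ : ∀ s : Set Θ, #s < #Θ → ∃ b, ∀ a ∈ s, a < b) (hJ : #J ≤ #Θ)
    {p : Y → Prop} (hp : ∃ᶠ ζ in clubFilter Y, p ζ) : HasLargeAntichain f p J := by
  set p' : Y → Prop := fun ζ => p ζ ∧ ∀ a, ∃ᶠ ξ in clubFilter Y, p ξ ∧
      ξ ∈ cone f (Node.restrict (f ζ) a) with hp'
  let sp : Y → Set Θ := fun ζ => {a | ∃ ζ', p' ζ' ∧ (∀ b < a, f ζ' b = f ζ b) ∧ f ζ' a ≠ f ζ a}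
  by_cases hwide : ∃ ζ, p' ζ ∧ #Θ ≤ #(sp ζ)
  · obtain ⟨ζ, -, hsp⟩ := hwide
    have hex : ∀ a : sp ζ, ∃ ζ', p' ζ' ∧ (∀ b < a.1, f ζ' b = f ζ b) ∧ f ζ' a ≠ f ζ a :=
      fun a => a.2
    choose z hz hagree hne using hex
    have key : ∀ a b : sp ζ, a.1 < b.1 → Disjoint (cone f (Node.restrict (f (z a)) a))
        (cone f (Node.restrict (f (z b)) b)) := by
      intro a b hab
      refine Set.disjoint_left.2 fun ξ h h' => hne a ?_
      rw [mem_cone_restrict] at h h'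
      rw [← h a le_rfl, h' a hab.le, hagree b a hab]
    refine HasLargeAntichain.mono (fun _ h => h) (hJ.trans hsp)
      ⟨fun a : sp ζ => Node.restrict (f (z a)) a, fun a b hab => ?_, fun a => (hz a).2 a⟩
    obtain h | h := lt_or_gt_of_ne fun h => hab (Subtype.ext h)
    · exact key a b h
    · exact (key b a h).symm
  · exfalso
    push Not at hwide
    have hbd : ∀ ζ, ∃ b, p' ζ → ∀ a ∈ sp ζ, a < b := by
      intro ζ
      by_cases h : p' ζ
      · obtain ⟨b, hb⟩ := hΘ _ (hwide ζ h)
        exact ⟨b, fun _ => hb⟩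
      · obtain ⟨b, -⟩ := hΘ ∅ (by
          rw [mk_eq_zero, pos_iff_ne_zero, mk_ne_zero_iff]
          obtain ⟨ζ', hζ'⟩ := (frequently_large (f := f) hT hp).exists
          obtain ⟨ζ, ζ', -, -, hlt⟩ := frequently_two hp
          obtain ⟨a, -⟩ := exists_first_difference (hf.ne hlt.ne)
          exact ⟨a⟩)
        exact ⟨b, fun h' => (h h').elim⟩
    choose b hb using hbd
    obtain ⟨n, hn⟩ := frequently_exists_small (α := Y) (ι := Node Θ W)
      (p := fun n ζ => p' ζ ∧ Node.restrict (f ζ) (b ζ) = n) (by simpa using hT)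
      ((frequently_large (f := f) hT hp).mono fun ζ hζ => ⟨_, hζ, rfl⟩)
    obtain ⟨ζ, ζ', hζ, hζ', hlt⟩ := frequently_two hn
    obtain ⟨a, ha, hagree⟩ := exists_first_difference (hf.ne hlt.ne)
    have hres := hζ.2.trans hζ'.2.symm
    have hb' : b ζ = b ζ' := congrArg Sigma.fst hres
    rw [← hb', restrict_eq_iff] at hres
    refine ha (hres a (hb ζ hζ.1 a ⟨ζ', hζ'.1, fun c hc => (hagree c hc).symm, fun h => ha h.symm⟩).le)

theorem mk_le_succ_of_forall_Iio {L : Type v} [LinearOrder L] [WellFoundedLT L] {σ : Cardinal.{v}}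
    (h : ∀ a : L, #(Iio a) ≤ σ) : #L ≤ Order.succ σ := by
  by_contra hc
  have hlt : (Order.succ σ).ord < Ordinal.type (α := L) (· < ·) := by
    refine lt_of_not_ge fun hle => hc ?_
    have := Ordinal.card_le_card hle
    rwa [Ordinal.card_type, card_ord] at this
  obtain ⟨a, ha⟩ := Ordinal.typein_surj (α := L) (· < ·) hlt
  have hcard : #(Iio a) = Order.succ σ := by
    rw [← card_ord (Order.succ σ), ← ha]
    exact (Ordinal.card_typein (α := L) (r := (· < ·)) a).symm
  exact (Order.lt_succ σ).not_ge (hcard ▸ h a)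

/-- Without an antichain every level has fewer than `σ` large nodes. Pairs of nodes at a level
determine the earlier places of first difference, so there are at most `σ⁺` such places. A branch is
determined by its nodes there, leaving at most `σ⁺ ^ σ⁺ < #Y` branches. -/
theorem hasLargeAntichain_of_power_lt {f : Y → Θ → W} (hf : Function.Injective f)
    (hT : #(Node Θ W) < #Y) {σ : Cardinal.{v}} (hσ : ℵ₀ ≤ σ)
    (hpow : Order.succ σ ^ Order.succ σ < #Y) (hJ : #J ≤ σ)
    {p : Y → Prop} (hp : ∃ᶠ ζ in clubFilter Y, p ζ) : HasLargeAntichain f p J := by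
  by_contra hcon
  set p' : Y → Prop := fun ζ => p ζ ∧ ∀ a, ∃ᶠ ξ in clubFilter Y, p ξ ∧
      ξ ∈ cone f (Node.restrict (f ζ) a) with hp'
  let N : Θ → Set (Node Θ W) := fun a => {n | ∃ ζ, p' ζ ∧ n = Node.restrict (f ζ) a}
  have hN : ∀ a, #(N a) < σ := by
    intro a
    by_contra hc
    refine hcon (hasLargeAntichain_of_set (N := N a) ?_ ?_ (hJ.trans (not_lt.1 hc)))
    · rintro _ ⟨ζ, hζ, rfl⟩ _ ⟨ζ', hζ', rfl⟩ hne
      refine Set.disjoint_left.2 fun ξ h h' => hne ?_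
      rw [mem_cone_restrict] at h h'
      exact restrict_eq_iff.2 fun i hi => (h i hi).symm.trans (h' i hi)
    · rintro _ ⟨ζ, hζ, rfl⟩
      exact hζ.2 a
  let L : Set Θ := {a | ∃ ζ ζ', p' ζ ∧ p' ζ' ∧ (∀ b < a, f ζ b = f ζ' b) ∧ f ζ a ≠ f ζ' a}
  have hex : ∀ a : L, ∃ ζ ζ', p' ζ ∧ p' ζ' ∧ (∀ b < a.1, f ζ b = f ζ' b) ∧ f ζ a ≠ f ζ' a :=
    fun a => a.2
  choose z z' hz hz' hagree hne using hex
  have hL : #L ≤ Order.succ σ := by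
    refine mk_le_succ_of_forall_Iio fun a => ?_
    have key : ∀ b b' : Iio a, Node.restrict (f (z b)) a.1 = Node.restrict (f (z b')) a →
        Node.restrict (f (z' b)) a.1 = Node.restrict (f (z' b')) a → ¬ b.1.1 < b'.1.1 := by
      intro b b' h1 h2 hlt
      have hb : b.1.1 ≤ a.1 := le_of_lt b.2
      rw [restrict_eq_iff] at h1 h2
      refine hne b ?_
      rw [h1 _ hb, h2 _ hb]
      exact hagree b'.1 _ hlt
    have hinj : Function.Injective fun b : Iio a =>
        ((⟨_, z b, hz b, rfl⟩, ⟨_, z' b, hz' b, rfl⟩) : N a.1 × N a.1) := by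
      intro b b' h
      simp only [Prod.mk.injEq, Subtype.mk.injEq] at h
      obtain hlt | heq | hlt := lt_trichotomy b.1.1 b'.1.1
      · exact (key b b' h.1 h.2 hlt).elim
      · exact Subtype.ext (Subtype.ext heq)
      · exact (key b' b h.1.symm h.2.symm hlt).elim
    refine (mk_le_of_injective hinj).trans ?_
    rw [mk_prod, lift_id]
    exact mul_le_of_le hσ (hN a).le (hN a).le
  have hσ' : ℵ₀ ≤ Order.succ σ := hσ.trans (Order.le_succ σ)
  let M : Set (Node Θ W) := ⋃ a : L, N a
  have hM : #M ≤ Order.succ σ := by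
    refine (mk_iUnion_le_sum_mk).trans ?_
    refine (Cardinal.sum_le_sum _ (fun _ => σ) fun a : L => (hN a).le).trans ?_
    rw [Cardinal.sum_const, lift_id, lift_id]
    exact mul_le_of_le hσ' hL (Order.le_succ σ)
  let F : {ζ | p' ζ} → L → M := fun ζ a =>
    ⟨Node.restrict (f ζ) a, mem_iUnion.2 ⟨a, ζ, ζ.2, rfl⟩⟩
  have hF : Function.Injective F := by
    intro ζ ζ' h
    by_contra hne
    obtain ⟨a, ha, hag⟩ := exists_first_difference (hf.ne fun h => hne (Subtype.ext h))
    have := congrArg Subtype.val (congrFun h ⟨a, ζ, ζ', ζ.2, ζ'.2, hag, ha⟩)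
    exact ha (restrict_eq_iff.1 this a le_rfl)
  have h1 := mk_le_of_injective hF
  rw [mk_setOf_frequently (frequently_large hT hp), ← power_def] at h1
  refine hpow.not_ge (h1.trans ((power_le_power_right hM).trans
    (power_le_power_left (aleph0_pos.trans_le hσ').ne' hL)))

/-- Take an antichain indexed by a small cofinal set `s`, and inside the cone of its `i`-th node an
antichain indexed by `Iic i`. An element `x` of `K` gets the `x`-th node in the cone of some `i ≥ x`
from `s`. -/
theorem hasLargeAntichain_of_singular {f : Y → Θ → W} {K : Type v} [LinearOrder K] {s : Set K}
    (hs : IsCofinal s) (hsK : #s < #K) (hK : ∀ i : K, #(Iic i) < #K) {p : Y → Prop}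
    (hp : ∃ᶠ ζ in clubFilter Y, p ζ)
    (h : ∀ p' : Y → Prop, (∀ ζ, p' ζ → p ζ) → (∃ᶠ ζ in clubFilter Y, p' ζ) →
      ∀ J : Type v, #J < #K → HasLargeAntichain f p' J) : HasLargeAntichain f p K := by
  obtain ⟨n, hn, hnp⟩ := h p (fun _ h => h) hp s hsK
  choose q hq hqp using fun i : s => h (fun ζ => p ζ ∧ ζ ∈ cone f (n i)) (fun _ h => h.1) (hnp i)
    (Iic i.1) (hK i)
  have hk : ∀ (i : s) (j : Iic i.1), ∃ k, cone f k = cone f (n i) ∩ cone f (q i j) := by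
    intro i j
    obtain ⟨ζ, hζ⟩ := (hqp i j).exists
    obtain h | h := cone_subset_or hζ.1.2 hζ.2
    · exact ⟨n i, (inter_eq_left.2 h).symm⟩
    · exact ⟨q i j, (inter_eq_right.2 h).symm⟩
  choose k hk using hk
  have hdisj : ∀ (i i' : s) (x : Iic i.1) (y : Iic i'.1), x.1 ≠ y.1 →
      Disjoint (cone f (k i x)) (cone f (k i' y)) := by
    intro i i' x y hxy
    rw [hk, hk]
    by_cases hi : i = i'
    · subst hi
      exact (hq i fun h => hxy (congrArg Subtype.val h)).mono inter_subset_right inter_subset_right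
    · exact (hn hi).mono inter_subset_left inter_subset_left
  choose c hcs hc using hs
  refine ⟨fun x => k ⟨c x, hcs x⟩ ⟨x, hc x⟩, fun x y hxy => hdisj _ _ _ _ hxy, fun x => ?_⟩
  refine (hqp ⟨c x, hcs x⟩ ⟨x, hc x⟩).mono fun ζ hζ => ⟨hζ.1.1, ?_⟩
  rw [hk]
  exact ⟨hζ.1.2, hζ.2⟩

end FunctionTree

/-! ### Cardinal arithmetic for the power condition -/

theorem mk_Iic_toType_lt {c : Cardinal.{v}} (hc : ℵ₀ ≤ c) (a : c.ord.ToType) : #(Iic a) < c := by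
  rw [← Iio_insert]
  exact (mk_insert_le).trans_lt
    (add_lt_of_lt hc (by simpa using Cardinal.mk_Iio_lt a (by simp)) (one_lt_aleph0.trans_le hc))

theorem exists_gt_toType {c : Cardinal.{v}} (hc : c.IsRegular) (s : Set c.ord.ToType) (hs : #s < c) :
    ∃ b, ∀ a ∈ s, a < b := by
  refine not_isCofinal_iff.1 fun h => hs.not_ge ?_
  have := Order.cof_le h
  rwa [Ordinal.cof_toType, hc.cof_ord] at this

/-- If `χ` is regular and `x ^ θ < c` for all `θ ≤ x < χ`, then `χ ^ θ < c` for `θ < χ`. -/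
theorem power_lt_of_regular {χ c θ : Cardinal.{v}} (hc : c.IsRegular) (hχ : χ.IsRegular)
    (hχc : χ < c) (hmin : ∀ x < χ, ∀ θ ≤ x, x ^ θ < c) (hθ : θ < χ) : χ ^ θ < c := by
  let W := χ.ord.ToType
  have hW : #W = χ := by simp [W]
  let F : (Σ b : W, (θ.out → Iic b)) → (θ.out → W) := fun g i => g.2 i
  -- By regularity every function from `θ < χ` to `χ` is bounded.
  have hF : Function.Surjective F := by
    intro g
    obtain ⟨b, hb⟩ := exists_gt_toType hχ (range g) (mk_range_le.trans_lt (by simpa using hθ))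
    exact ⟨⟨b, fun i => ⟨g i, (hb _ ⟨i, rfl⟩).le⟩⟩, rfl⟩
  have h1 := mk_le_of_surjective hF
  rw [← power_def, hW, mk_out] at h1
  refine h1.trans_lt ?_
  rw [mk_sigma]
  refine sum_lt_of_isRegular hc (by rwa [hW]) fun b => ?_
  rw [← power_def, mk_out]
  have hb : #(Iic b) < χ := mk_Iic_toType_lt hχ.aleph0_le b
  exact (power_le_power_right (le_max_left _ θ)).trans_lt
    (hmin _ (max_lt hb hθ) θ (le_max_right _ _))

theorem splits_of_power {Y J : Type v} [LinearOrder Y] [WellFoundedLT Y]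
    [UncountableRegularOrder Y] {χ : Cardinal.{v}} (hχY : χ < #Y) (hex : ∃ θ ≤ χ, #Y ≤ χ ^ θ)
    (hmin : ∀ x < χ, ∀ θ ≤ x, x ^ θ < #Y) (hJ : #J ≤ χ) : Splits Y J := by
  have hne : {θ : Cardinal.{v} | #Y ≤ χ ^ θ}.Nonempty := let ⟨θ, _, h⟩ := hex; ⟨θ, h⟩
  -- The least exponent `θ` makes each level of the tree smaller than `#Y`, hence the whole tree,
  -- while there are still `#Y` branches.
  obtain ⟨θ, hθ, hθmin, hθχ⟩ : ∃ θ, #Y ≤ χ ^ θ ∧ (∀ θ' < θ, χ ^ θ' < #Y) ∧ θ ≤ χ := by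
    refine ⟨sInf _, csInf_mem hne, fun θ' h => not_le.1 fun hc => h.not_ge (csInf_le' hc), ?_⟩
    obtain ⟨θ, h1, h2⟩ := hex
    have h3 : sInf {θ | #Y ≤ χ ^ θ} ≤ θ := csInf_le' h2
    exact h3.trans h1
  have hY := isRegular_mk Y
  have hχ : ℵ₀ ≤ χ := by
    by_contra hc
    push Not at hc
    exact (power_lt_aleph0 hc (hθχ.trans_lt hc)).not_ge (hY.aleph0_le.trans hθ)
  have hθ0 : ℵ₀ ≤ θ := by
    by_contra hc
    push Not at hc
    obtain ⟨n, rfl⟩ := lt_aleph0.1 hc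
    exact (power_nat_le hχ).not_gt (hχY.trans_le hθ)
  let Θ := θ.ord.ToType
  let W := χ.ord.ToType
  have hΘ : #Θ = θ := by simp [Θ]
  have hW : #W = χ := by simp [W]
  have hT : #(Node Θ W) < #Y := by
    rw [mk_sigma]
    refine sum_lt_of_isRegular hY (by rw [hΘ]; exact hθχ.trans_lt hχY) fun a => ?_
    rw [← power_def, hW]
    exact hθmin _ (mk_Iic_toType_lt hθ0 a)
  obtain ⟨f, hf⟩ : ∃ f : Y → Θ → W, Function.Injective f := by
    have : #Y ≤ #(Θ → W) := by rwa [← power_def, hΘ, hW]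
    obtain ⟨e⟩ := Cardinal.le_def _ _ |>.1 this
    exact ⟨e, e.injective⟩
  refine ⟨Node Θ W, hT.le, cone f, fun p hp => ?_⟩
  change HasLargeAntichain f p J
  obtain hreg | hsing := isRegular_or_isSingular hχ
  · have hθeq : θ = χ := hθχ.eq_of_not_lt fun h =>
      (power_lt_of_regular hY hreg hχY hmin h).not_ge hθ
    subst hθeq
    exact hasLargeAntichain_of_regular hf hT (by rw [hΘ]; exact exists_gt_toType hreg)
      (by rwa [hΘ]) hp
  · by_contra hcon
    obtain ⟨s, hs, hs'⟩ := Order.exists_cof_eq W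
    refine hcon (HasLargeAntichain.mono (fun _ h => h) (hJ.trans hW.ge)
      (hasLargeAntichain_of_singular hs ?_ (fun i => by rw [hW]; exact mk_Iic_toType_lt hχ i) hp ?_))
    · rw [hs', hW, Ordinal.cof_toType]
      exact hsing.cof_ord_lt
    · intro p' hpp' hp' J' hJ'
      rw [hW] at hJ'
      have hℵ : ℵ₀ < χ := lt_of_le_of_ne hχ fun h => not_isSingular_aleph0 (h ▸ hsing)
      have hσ : max #J' ℵ₀ < χ := max_lt hJ' hℵ
      -- A singular cardinal is not a successor, so the minimality of `χ` applies to `σ⁺` with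
      -- exponent `σ⁺`.
      have hsucc : Order.succ (max #J' ℵ₀) < χ := lt_of_le_of_ne (Order.succ_le_of_lt hσ)
        fun h => not_isSingular_succ _ (h ▸ hsing)
      exact hasLargeAntichain_of_power_lt hf hT (le_max_right _ _) (hmin _ hsucc _ le_rfl)
        (le_max_left _ _) hp'

/-! ### The orders `Below κ` -/

theorem mk_below (κ : Cardinal.{u}) : #(Below κ) = lift.{u + 1} κ := by
  rw [Cardinal.mk_Iio_ordinal, card_ord]

/-- The initial segments of `Below κ` are initial segments of the ordinals. -/
def iioBelowIso {κ : Cardinal.{u}} (x : Below κ) : Iio x ≃o Iio (x : Ordinal.{u}) where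
  toFun y := ⟨y.1.1, y.2⟩
  invFun y := ⟨⟨y.1, lt_trans (show y.1 < x.1 from y.2) x.2⟩, y.2⟩
  left_inv _ := rfl
  right_inv _ := rfl
  map_rel_iff' := Iff.rfl

theorem mk_Iio_below {κ : Cardinal.{u}} (x : Below κ) :
    #(Iio x) = lift.{u + 1} (x : Ordinal.{u}).card := by
  rw [Cardinal.mk_congr (iioBelowIso x).toEquiv, Cardinal.mk_Iio_ordinal]

theorem cof_Iio_below {κ : Cardinal.{u}} (x : Below κ) :
    Order.cof (Iio x) = lift.{u + 1} (x : Ordinal.{u}).cof := by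
  rw [(iioBelowIso x).cof_congr, Ordinal.cof_Iio, Ordinal.lift_cof]

theorem uncountableRegularOrder_below {κ : Cardinal.{u}} (h : κ.IsRegular) (h' : ℵ₀ < κ) :
    UncountableRegularOrder (Below κ) := by
  have hcof : Order.cof (Below κ) = lift.{u + 1} κ := by
    rw [Ordinal.cof_Iio, ← Ordinal.lift_cof, h.cof_ord]
  have htype : Ordinal.type (α := Below κ) (· < ·) = Ordinal.lift.{u + 1} κ.ord :=
    Ordinal.typein_ordinal κ.ord
  refine { type_lt_le_ord_cof := ?_, aleph0_lt_cof := ?_ }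
  · rw [hcof, htype, Cardinal.lift_ord]
  · rw [hcof]
    simpa using h'

theorem splits_one {Y : Type v} [LinearOrder Y] [WellFoundedLT Y] [UncountableRegularOrder Y]
    {J : Type v} [Subsingleton J] : Splits Y J :=
  ⟨PUnit, by rw [mk_punit]; exact (one_lt_aleph0.trans (aleph0_lt_mk Y)).le, fun _ => univ,
    fun p hp => ⟨fun _ => PUnit.unit, fun i j hij => (hij (Subsingleton.elim i j)).elim,
      fun j => hp.mono fun ζ hζ => ⟨hζ, trivial⟩⟩⟩

/-! ### Splitting from each admissible condition -/

section Splitting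

variable {κ χ : Cardinal.{u}} [UncountableRegularOrder (Below κ)]

theorem isSingularAt_of_card_le {θ ζ : Below κ} (h : θ < ζ)
    (hcard : (ζ : Ordinal.{u}).cof ≤ (θ : Ordinal.{u}).card) : ∃ θ c, IsSingularAt ζ θ c := by
  obtain ⟨c, hc⟩ := exists_isSingularAt h (by
    rw [mk_Iio_below, cof_Iio_below]; exact Cardinal.lift_le.2 hcard)
  exact ⟨θ, c, hc⟩

theorem eventually_isSingularAt_succ (κ : Cardinal.{u})
    [UncountableRegularOrder (Below (Order.succ κ))] :
    ∀ᶠ ζ in clubFilter (Below (Order.succ κ)), ∃ θ c, IsSingularAt ζ θ c := by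
  have hlt : κ.ord < (Order.succ κ).ord := ord_lt_ord.2 (Order.lt_succ κ)
  filter_upwards [eventually_clubFilter_gt (⟨κ.ord, hlt⟩ : Below (Order.succ κ))] with ζ hζ
  refine isSingularAt_of_card_le hζ ((Ordinal.cof_le_card _).trans ?_)
  rw [card_ord, ← Order.lt_succ_iff, ← Cardinal.lt_ord]
  exact ζ.2

theorem splits_of_hasTree (h : HasTree κ χ) : Splits (Below κ) (Below χ) := by
  obtain ⟨T, _, Γ, hT, hTκ, hΓ, hΓκ, hanti⟩ := h
  obtain ⟨e⟩ : Nonempty (Below κ ≃ Γ) := by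
    rw [← Cardinal.lift_mk_eq', mk_below, hΓκ, lift_lift]
  refine splits_of_tree hT (by rw [mk_below]; simpa using hTκ) (fun ζ => (e ζ).1)
    (fun ζ => hΓ _ (e ζ).2) fun T' hT' hmk => ?_
  obtain ⟨A, hA, hA', hχ⟩ := hanti T' hT' (by
    have e' : {ζ | (e ζ).1 ⊆ T'} ≃ {η : Set T | η ∈ Γ ∧ η ⊆ T'} :=
      { toFun := fun ζ => ⟨(e ζ.1).1, (e ζ.1).2, ζ.2⟩
        invFun := fun η => ⟨e.symm ⟨η.1, η.2.1⟩, by simpa using η.2.2⟩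
        left_inv := fun ζ => by simp
        right_inv := fun η => by simp }
    have := Cardinal.lift_mk_eq'.2 ⟨e'⟩
    rw [hmk, mk_below] at this
    simpa using this.symm)
  exact ⟨A, hA, hA', by rw [mk_below]; simpa using hχ⟩

/-- As `κ` is not a strong limit, `κ ≤ 2 ^ μ` for some `μ < κ`, and then `max μ ℵ₀`, as base and
exponent, belongs to the set. -/
theorem lt_of_isLeast_power (hκ : κ.IsRegular) (hκ' : ℵ₀ < κ) (hn : ¬ κ.IsInaccessible)
    (h : IsLeast {x : Cardinal.{u} | ∃ θ ≤ x, κ ≤ x ^ θ} χ) : χ < κ := by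
  have : ¬ κ.IsStrongPrelimit := fun h => hn ⟨hκ', hκ.cof_ord.ge, h⟩
  obtain ⟨μ, hμ, hμκ⟩ : ∃ μ < κ, κ ≤ 2 ^ μ := by
    by_contra hc
    push Not at hc
    exact this fun μ hμ => hc μ hμ
  refine (h.2 ⟨max μ ℵ₀, le_rfl, hμκ.trans ?_⟩).trans_lt (max_lt hμ hκ')
  exact (power_le_power_right ((natCast_lt_aleph0 (n := 2)).le.trans (le_max_right _ _))).trans
    (power_le_power_left (aleph0_pos.trans_le (le_max_right _ _)).ne' (le_max_left _ _))

theorem splits_of_isLeast_power (hχ : χ < κ)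
    (h : IsLeast {x : Cardinal.{u} | ∃ θ ≤ x, κ ≤ x ^ θ} χ) : Splits (Below κ) (Below χ) := by
  obtain ⟨⟨θ, hθ, hκ⟩, hmin⟩ := h
  refine splits_of_power (χ := lift.{u + 1} χ) ?_ ⟨lift.{u + 1} θ, ?_, ?_⟩ ?_ (mk_below χ).le
  · rw [mk_below]; simpa using hχ
  · simpa using hθ
  · rw [mk_below, ← lift_power]; exact Cardinal.lift_le.2 hκ
  · intro x hx θ hθ
    obtain ⟨x, rfl⟩ := mem_range_lift_of_le hx.le
    obtain ⟨θ, rfl⟩ := mem_range_lift_of_le hθ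
    rw [mk_below, ← lift_power, lift_lt]
    rw [lift_lt] at hx
    rw [Cardinal.lift_le] at hθ
    exact not_le.1 fun hc => hx.not_ge (hmin ⟨θ, hθ, hc⟩)

/-- A point above `ω` whose cofinality exceeds the cardinality of each smaller point is a regular
cardinal; closure under `ξ ↦ |ξ|⁺` makes it a limit cardinal. -/
theorem eventually_isSingularAt_or_inacc (h : κ.IsInaccessible) :
    ∀ᶠ ζ in clubFilter (Below κ), (∃ θ c, IsSingularAt ζ θ c) ∨ ζ ∈ inaccBelow κ := by
  have hlim : ∀ c < κ, Order.succ c < κ := fun c hc =>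
    (Order.succ_le_of_lt (cantor c)).trans_lt (h.isStrongPrelimit hc)
  have hlim' : ∀ ξ : Below κ, (Order.succ (ξ : Ordinal.{u}).card).ord < κ.ord := fun ξ =>
    ord_lt_ord.2 (hlim _ (Cardinal.lt_ord.1 ξ.2))
  have hω : (ℵ₀ : Cardinal.{u}).ord < κ.ord := ord_lt_ord.2 h.aleph0_lt
  filter_upwards [eventually_closed fun ξ : Below κ => (⟨_, hlim' ξ⟩ : Below κ),
    eventually_clubFilter_gt (⟨_, hω⟩ : Below κ)] with ζ hζ hζω
  by_contra hcon
  rw [not_or] at hcon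
  have hcof : ∀ θ < ζ, (θ : Ordinal.{u}).card < (ζ : Ordinal.{u}).cof := fun θ hθ =>
    not_le.1 fun hc => hcon.1 (isSingularAt_of_card_le hθ hc)
  set m := (ζ : Ordinal.{u}).card with hm
  have hle : m.ord ≤ (ζ : Ordinal.{u}) := ord_card_le _
  have hmζ : m.ord = (ζ : Ordinal.{u}) := by
    refine hle.eq_of_not_lt fun hlt => ?_
    have := hcof ⟨m.ord, hlt.trans ζ.2⟩ hlt
    rw [card_ord] at this
    exact (Ordinal.cof_le_card _).not_gt this
  have hm0 : ℵ₀ < m := by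
    have h1 : (ℵ₀ : Cardinal.{u}).ord < (ζ : Ordinal.{u}) := hζω
    rw [← hmζ] at h1
    exact ord_lt_ord.1 h1
  refine hcon.2 ⟨m, ⟨hm0, ⟨hm0.le, ?_⟩, ?_⟩, hmζ.symm⟩
  · by_contra hc
    push Not at hc
    have hlt : m.ord.cof.ord < (ζ : Ordinal.{u}) := by
      rw [← hmζ]; exact ord_lt_ord.2 hc
    have := hcof ⟨_, hlt.trans ζ.2⟩ hlt
    rw [card_ord, hmζ] at this
    exact lt_irrefl _ this
  · refine Cardinal.isSuccLimit_iff.2 ⟨(aleph0_pos.trans hm0).ne', ?_⟩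
    rw [isSuccPrelimit_iff_succ_ne]
    intro c hc
    have hlt : c.ord < (ζ : Ordinal.{u}) := by
      rw [← hmζ, ← hc]; exact ord_lt_ord.2 (Order.lt_succ c)
    have h2 : (Order.succ (c.ord).card).ord < (ζ : Ordinal.{u}) := hζ ⟨_, hlt.trans ζ.2⟩ hlt
    rw [card_ord, hc, hmζ] at h2
    exact lt_irrefl _ h2

theorem splits_of_notIneffable (h : κ.IsInaccessible) (h' : NotIneffable κ) (hχ : χ < κ) :
    Splits (Below κ) (Below χ) := by
  have hJ : #(Below χ) < #(Below κ) := by rw [mk_below, mk_below]; simpa using hχ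
  obtain ⟨A, hA, hA'⟩ := h'
  refine ((splitsOn_isSingularAt hJ.le).or (splitsOn_of_not_ineffable (A := A) ?_ hJ ?_)).splits
    (eventually_isSingularAt_or_inacc h)
  · intro x hx
    rw [mk_below] at hx ⊢
    obtain ⟨x, rfl⟩ := mem_range_lift_of_le hx.le
    rw [lift_lt] at hx
    rw [← lift_two_power, lift_lt]
    exact h.isStrongPrelimit hx
  · intro B hB
    refine hA' ⟨{ζ | ζ ∈ inaccBelow κ ∧ ∀ ξ < ζ, ξ ∈ A ζ ↔ ξ ∈ B}, fun ζ hζ => hζ.1,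
      isStationary_iff_frequently.2 hB, B, fun ζ hζ => ?_⟩
    ext ξ
    constructor
    · intro hξ
      have := hA ζ hζ.1 hξ
      exact ⟨(hζ.2 ξ this).1 hξ, this⟩
    · rintro ⟨hξ, hlt⟩
      exact (hζ.2 ξ hlt).2 hξ

theorem splits_of_admissible (hκ : κ.IsRegular) (hκ' : ℵ₀ < κ) (h : Admissible κ χ) :
    0 < χ ∧ χ < κ ∧ Splits (Below κ) (Below χ) := by
  cases h with
  | succ h =>
    subst h
    refine ⟨?_, Order.lt_succ χ, (splitsOn_isSingularAt ?_).splits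
      (eventually_isSingularAt_succ χ)⟩
    · rw [pos_iff_ne_zero]
      rintro rfl
      rw [succ_zero] at hκ'
      exact hκ'.not_gt one_lt_aleph0
    · rw [mk_below, mk_below]
      exact Cardinal.lift_le.2 (Order.le_succ χ)
  | tree h1 h2 h3 h4 h5 => exact ⟨h3, h4, splits_of_hasTree h5⟩
  | power h1 h2 h3 =>
    have hlt := lt_of_isLeast_power hκ hκ' h2 h3
    refine ⟨?_, hlt, splits_of_isLeast_power hlt h3⟩
    rw [pos_iff_ne_zero]
    rintro rfl
    obtain ⟨θ, hθ, hle⟩ := h3.1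
    rw [nonpos_iff_eq_zero.1 hθ, power_zero] at hle
    exact hle.not_gt (one_lt_aleph0.trans hκ')
  | ineffable h1 h2 h3 h4 => exact ⟨h3, h4, splits_of_notIneffable h1 h2 h4⟩

end Splitting

/-! ### Partitioning `S` and rebuilding ladders -/

section Generic

variable {X Y : Type v} [LinearOrder X] [WellFoundedLT X]
  [LinearOrder Y] [WellFoundedLT Y] [UncountableRegularOrder Y]

theorem exists_partition [UncountableRegularOrder X] {S : Set X} (hS : IsStationary S)
    (hsing : ∀ᶠ δ in clubFilter X, ∃ θ c, IsSingularAt δ θ c) {I : Type v} [Nonempty I]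
    (hI : #I ≤ #X) : ∃ π : X → I, ∀ i, IsStationary {δ | δ ∈ S ∧ π δ = i} := by
  obtain ⟨ι, hι, U, hU⟩ := splitsOn_isSingularAt (Y := X) hI
  obtain ⟨q, hq, hqS⟩ := hU (· ∈ S) ((isStationary_iff_frequently.1 hS).and_eventually hsing)
  classical
  refine ⟨fun δ => if h : ∃ i, δ ∈ U (q i) then h.choose else Classical.arbitrary I, fun i => ?_⟩
  refine isStationary_iff_frequently.2 ((hqS i).mono fun δ hδ => ⟨hδ.1, ?_⟩)
  have h : ∃ i, δ ∈ U (q i) := ⟨i, hδ.2⟩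
  simp only [dif_pos h]
  by_contra hne
  exact (hq hne).le_bot ⟨h.choose_spec, hδ.2⟩

theorem IsLadder.eventually_eq {δ : X} {a b : Y → X} (ha : IsLadder δ a) (hb : IsLadder δ b) :
    ∀ᶠ ζ in clubFilter Y, a ζ = b ζ := by
  have h : ∀ ζ, ∃ ζ', a ζ < b ζ' ∧ b ζ < a ζ' := fun ζ => by
    obtain ⟨ξ, h1⟩ := hb.cofinal _ (ha.lt ζ)
    obtain ⟨ξ', h2⟩ := ha.cofinal _ (hb.lt ζ)
    exact ⟨max ξ ξ', h1.trans_le (hb.isNormal.monotone (le_max_left _ _)),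
      h2.trans_le (ha.isNormal.monotone (le_max_right _ _))⟩
  choose f hf hf' using h
  obtain ⟨y⟩ := nonempty_of_uncountable Y
  have hlt : ∀ ζ : Y, ∃ ζ', ζ < ζ' := fun ζ => exists_gt ζ
  choose g hg using hlt
  filter_upwards [eventually_closed f, eventually_closed g, eventually_clubFilter_gt y]
    with ζ hζ hζ' hy
  have hlub : IsLUB (Iio ζ) ζ := ⟨fun x hx => le_of_lt hx, fun c hc => not_lt.1 fun h =>
    (hc (hζ' c h)).not_gt (hg c)⟩
  have hla := ha.isNormal.map_isLUB hlub ⟨y, hy⟩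
  have hlb := hb.isNormal.map_isLUB hlub ⟨y, hy⟩
  refine le_antisymm (hla.2 ?_) (hlb.2 ?_)
  · rintro _ ⟨ξ, hξ, rfl⟩
    exact (hf ξ).le.trans (hlb.1 ⟨_, hζ ξ hξ, rfl⟩)
  · rintro _ ⟨ξ, hξ, rfl⟩
    exact (hf' ξ).le.trans (hla.1 ⟨_, hζ ξ hξ, rfl⟩)

/-- A ladder can be modified so that it starts at a given point and its successor values follow a
given function. -/
theorem IsLadder.exists_follow {δ γ : X} {b F : Y → X} (hb : IsLadder δ b) (hγ : γ < δ)
    (hF : ∀ ζ, F ζ < δ) : ∃ a : Y → X, IsLadder δ a ∧ (∀ ζ, IsMin ζ → a ζ = γ) ∧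
      ∀ᶠ ζ in clubFilter Y, a ζ = b ζ ∧ ∀ ζ', ζ ⋖ ζ' → b ζ < F ζ → a ζ' = F ζ := by
  classical
  have hsucc : ∀ x < δ, ∃ y, x < y ∧ y < δ := fun x hx => by
    obtain ⟨ζ, hζ⟩ := hb.cofinal x hx
    exact ⟨_, hζ, hb.lt ζ⟩
  choose! sc hsc hsc' using hsucc
  obtain ⟨a, ha, han, hamin, hacov⟩ := exists_normal_of_step (Y := Y) hγ
    -- The step goes to `F ξ` only where the new ladder agrees with `b`, which happens at club many
    -- indices. In both cases the new point is at least `b ξ`, which keeps the ladder cofinal.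
    (fun ξ x => if x = b ξ ∧ b ξ < F ξ then F ξ else max (sc x) (b ξ))
    (fun ξ x hx => by
      split_ifs with h
      · exact ⟨h.1 ▸ h.2, hF ξ⟩
      · exact ⟨(hsc x hx).trans_le (le_max_left _ _), max_lt (hsc' x hx) (hb.lt ξ)⟩)
    (fun ζ f hf => by
      obtain ⟨ξ, hξ⟩ := hb.exists_bound (mk_Iio_lt ζ) f hf
      exact ⟨b ξ, hb.lt ξ, fun i => (hξ i).le⟩)
  have hla : IsLadder δ a := by
    refine ⟨han, ha, fun β hβ => ?_⟩
    obtain ⟨ξ, hξ⟩ := hb.cofinal β hβ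
    let _ := SuccOrder.ofLinearWellFoundedLT Y
    refine ⟨Order.succ ξ, ?_⟩
    rw [hacov ξ _ (covBy_succ ξ)]
    split_ifs with h
    · exact hξ.trans h.2
    · exact hξ.trans_le (le_max_right _ _)
  refine ⟨a, hla, hamin, (hla.eventually_eq hb).mono fun ζ hζ => ⟨hζ, fun ζ' hc hlt => ?_⟩⟩
  rw [hacov ζ ζ' hc, if_pos ⟨hζ, hlt⟩]

theorem IsLadder.isClub_range {δ : X} {a : Y → X} (ha : IsLadder δ a) :
    IsClub {β : Iio δ | (β : X) ∈ range a} := by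
  refine ⟨fun d hd hne _ x hx => ?_, fun β => ?_⟩
  · have hlub : IsLUB (Subtype.val '' d) x.1 := by
      refine ⟨by rintro _ ⟨y, hy, rfl⟩; exact hx.1 hy, fun c hc => ?_⟩
      by_contra hlt
      have hcδ : c < δ := (not_le.1 hlt).trans x.2
      have hub : (⟨c, hcδ⟩ : Iio δ) ∈ upperBounds d := fun y hy => hc ⟨y, hy, rfl⟩
      exact hlt (hx.2 hub)
    have := ha.mem_image_of_isLUB .univ (by rw [image_univ]; rintro _ ⟨y, hy, rfl⟩; exact hd hy)
      (hne.image _) hlub x.2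
    rwa [image_univ] at this
  · obtain ⟨ζ, hζ⟩ := ha.cofinal β β.2
    exact ⟨⟨a ζ, ha.lt ζ⟩, ⟨ζ, rfl⟩, le_of_lt hζ⟩

end Generic

/-! ### The filter of guesses -/

/-- The sets of the filter generated by a family of sets indexed by the clubs. -/
def guessFilter {κ : Cardinal.{u}} [UncountableRegularOrder (Below κ)]
    (G : Set (Below κ) → Set (Below κ)) (hG : Monotone G) : Filter (Below κ) where
  sets := {A | ∃ E, IsClub E ∧ G E ⊆ A}
  univ_sets := ⟨univ, .univ, subset_univ _⟩
  sets_of_superset := fun ⟨E, hE, h⟩ h' => ⟨E, hE, h.trans h'⟩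
  inter_sets := fun ⟨E, hE, h⟩ ⟨E', hE', h'⟩ =>
    ⟨E ∩ E', hE.inter UncountableRegularOrder.aleph0_lt_cof.ne' hE',
      subset_inter ((hG inter_subset_left).trans h) ((hG inter_subset_right).trans h')⟩

theorem IsNormalFilter.exists_positive_fiber {κ : Cardinal.{u}} {D : Filter (Below κ)}
    (hD : IsNormalFilter D) {A : Set (Below κ)} (hA : Positive D A) {f : Below κ → Below κ}
    (hf : ∀ δ ∈ A, f δ < δ) : ∃ α, Positive D {δ | δ ∈ A ∧ α = f δ} := by
  by_contra hcon
  simp only [Positive, not_exists, not_not] at hcon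
  refine hA (D.sets_of_superset (hD.diag_mem _ hcon) fun δ hδ hA' => ?_)
  exact hδ (f δ) (hf δ hA') ⟨hA', rfl⟩

theorem acc_mono {κ : Cardinal.{u}} {E E' : Set (Below κ)} (h : E ⊆ E') : acc E ⊆ acc E' :=
  fun _ hδ => ⟨hδ.1, limitPoints_mono h hδ.2⟩

section Guess

variable {κ : Cardinal.{u}} {S : Set (Below (Order.succ κ))}
  {a : Below (Order.succ κ) → Below κ → Below (Order.succ κ)}
  {h : Below (Order.succ κ) → Below (Order.succ κ) → Ordinal.{u}}
  {χ : Below (Order.succ κ) → Cardinal.{u}}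

theorem guessSet_eq_inter (E A : Set (Below (Order.succ κ))) :
    guessSet S a h χ E A = A ∩ guessSet S a h χ E univ := by
  ext δ
  exact ⟨fun h => ⟨h.1, trivial, h.2⟩, fun h => ⟨h.1, h.2.2⟩⟩

theorem guessSet_mono (A : Set (Below (Order.succ κ))) :
    Monotone fun E => guessSet S a h χ E A :=
  fun _ _ hE _ hδ => ⟨hδ.1, hδ.2.1, acc_mono hE hδ.2.2.1, fun i hi =>
    (hδ.2.2.2 i hi).mono fun _ hζ => ⟨hE hζ.1, hζ.2.1, hE hζ.2.2⟩⟩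

/-- A point of a diagonal intersection above `α` lies in `E α`, and for `α < δ` a tail of the ladder
of `δ` is above `α`; so a guess of the diagonal intersection at `δ` is a guess of `E α`. -/
theorem isNormalFilter_guessFilter [UncountableRegularOrder (Below κ)]
    [UncountableRegularOrder (Below (Order.succ κ))] (ha : ∀ δ ∈ S, IsLadder δ (a δ))
    (hne : ∀ E, IsClub E → (guessSet S a h χ E univ).Nonempty) :
    IsNormalFilter (guessFilter (fun E => guessSet S a h χ E univ) (guessSet_mono univ)) := by
  refine ⟨?_, fun α => ⟨Ioi α, isClub_Ioi α, fun δ hδ => ?_⟩, fun F hF => ?_⟩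
  · rintro ⟨E, hE, hsub⟩
    obtain ⟨δ, hδ⟩ := hne E hE
    exact hsub hδ
  · obtain ⟨ζ⟩ := nonempty_of_uncountable (Below κ)
    obtain ⟨γ, h1, -, h2⟩ := hδ.2.2.1.2 _ ((ha δ hδ.2.1).lt ζ)
    exact lt_trans h1 h2
  · choose E hE hEF using hF
    refine ⟨_, isClub_diag hE, fun δ hδ α hα => hEF α ⟨trivial, hδ.2.1, ⟨hδ.2.2.1.1, ?_⟩, ?_⟩⟩
    · intro β hβ
      obtain ⟨γ, hγ, h1, h2⟩ := hδ.2.2.1.2 (max α β) (max_lt hα hβ)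
      exact ⟨γ, hγ α ((le_max_left _ _).trans_lt h1), (le_max_right _ _).trans_lt h1, h2⟩
    · intro i hi
      have hl := ha δ hδ.2.1
      obtain ⟨ζ₀, hζ₀⟩ := hl.cofinal α hα
      rw [isStationary_iff_frequently]
      refine ((isStationary_iff_frequently.1 (hδ.2.2.2 i hi)).and_eventually
        (eventually_clubFilter_gt ζ₀)).mono fun ζ hζ => ?_
      have hαζ : α < a δ ζ := hζ₀.trans (hl.isNormal.strictMono hζ.2)
      exact ⟨hζ.1.1 α (hαζ.trans (hl.isNormal.strictMono (Order.lt_succ ζ))), hζ.1.2.1,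
        hζ.1.2.2 α hαζ⟩

end Guess

end ClubGuess

/-! ### Assembly of the theorem -/

open ClubGuess Set Filter in
theorem lemma3p6 (κ : Cardinal.{u}) (hreg : κ.IsRegular) (hunc : ℵ₀ < κ)
    (S : Set (ClubGuess.Below (Order.succ κ)))
    (hcof : ∀ δ ∈ S, (δ : Ordinal.{u}).cof = κ) (hS : IsStationary S) :
    ∃ (D : Filter (ClubGuess.Below (Order.succ κ)))
      (C : ClubGuess.Below (Order.succ κ) → Set (ClubGuess.Below (Order.succ κ)))
      (a : ClubGuess.Below (Order.succ κ) → ClubGuess.Below κ → ClubGuess.Below (Order.succ κ))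
      (h : ClubGuess.Below (Order.succ κ) → ClubGuess.Below (Order.succ κ) → Ordinal.{u})
      (χ : ClubGuess.Below (Order.succ κ) → Cardinal.{u}),
      ClubGuess.IsNormalFilter D ∧
      (∀ δ ∈ S, C δ ⊆ Set.Iio δ ∧ IsClub {β : Set.Iio δ | (β : ClubGuess.Below (Order.succ κ)) ∈ C δ} ∧
        Order.IsNormal (a δ) ∧ C δ = Set.range (a δ)) ∧
      (∀ δ ∈ S, χ δ ≤ κ ∧ Set.MapsTo (h δ) (C δ) (Set.Iio (χ δ).ord)) ∧
      (∀ A : Set (ClubGuess.Below (Order.succ κ)), ClubGuess.Positive D A →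
        ∀ E : Set (ClubGuess.Below (Order.succ κ)), IsClub E →
          ClubGuess.Positive D (ClubGuess.guessSet S a h χ E A) ∧
          ∃ (α : ClubGuess.Below (Order.succ κ)) (ζ : ClubGuess.Below κ),
            ClubGuess.Positive D {δ | δ ∈ ClubGuess.guessSet S a h χ E A ∧ α = a δ ζ}) ∧
      (∀ (γ : ClubGuess.Below (Order.succ κ)) (χ₀ : Cardinal.{u}), ClubGuess.Admissible κ χ₀ →
        ClubGuess.Positive D {δ | δ ∈ S ∧ IsLeast (C δ) γ ∧ χ δ = χ₀}) := by
  classical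
  have hX := uncountableRegularOrder_below (isRegular_succ hreg.aleph0_le)
    (hunc.trans (Order.lt_succ κ))
  have hY := uncountableRegularOrder_below hreg hunc
  have hYX : #(Below κ) < #(Below (Order.succ κ)) := by
    rw [mk_below, mk_below, lift_lt]
    exact Order.lt_succ κ
  -- the possible numbers of colours
  let Q : Type (u + 1) := {χ : Cardinal.{u} // 0 < χ ∧ χ < κ ∧ Splits (Below κ) (Below χ)}
  have hone : 0 < (1 : Cardinal.{u}) ∧ 1 < κ ∧ Splits (Below κ) (Below (1 : Cardinal.{u})) := by
    refine ⟨zero_lt_one, one_lt_aleph0.trans hunc, ?_⟩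
    have : Subsingleton (Below (1 : Cardinal.{u})) := by
      rw [← Cardinal.le_one_iff_subsingleton, mk_below, lift_one]
    exact splits_one
  have : Nonempty Q := ⟨⟨1, hone⟩⟩
  have hQ : #Q ≤ #(Below (Order.succ κ)) := by
    refine le_trans ?_ hYX.le
    refine mk_le_of_injective (f := fun χ : Q => (⟨χ.1.ord, ord_lt_ord.2 χ.2.2.1⟩ : Below κ)) ?_
    intro χ χ' hχ
    exact Subtype.ext (ord_injective (congrArg Subtype.val hχ))
  have hXne := nonempty_of_uncountable (Below (Order.succ κ))
  -- Every large enough point of `κ⁺` has cofinality at most `κ` and lies above `κ`, so Solovay's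
  -- splitting applies on a club. The label of `δ` prescribes its first ladder point and its number
  -- of colours.
  obtain ⟨π, hπ⟩ := exists_partition hS (eventually_isSingularAt_succ κ)
    (I := Below (Order.succ κ) × Q) (by
      rw [mk_prod, lift_id, lift_id]
      exact mul_le_of_le (aleph0_lt_mk _).le le_rfl hQ)
  have hlad : ∀ δ : Below (Order.succ κ), ∃ b : Below κ → Below (Order.succ κ),
      δ ∈ S → IsLadder δ b := by
    intro δ
    by_cases hδ : δ ∈ S
    · obtain ⟨b, hb⟩ := exists_isLadder (Y := Below κ) (δ := δ)
        (by rw [cof_Iio_below, mk_below, hcof δ hδ])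
      exact ⟨b, fun _ => hb⟩
    · exact ⟨fun _ => δ, fun h => (hδ h).elim⟩
  choose b hb using hlad
  have hguess : ∀ i : Below (Order.succ κ) × Q,
      ∃ (F : Below (Order.succ κ) → Below κ → Below (Order.succ κ))
        (g : Below (Order.succ κ) → Below κ → Below i.2.1),
        (∀ δ ∈ {δ | δ ∈ S ∧ π δ = i}, ∀ ζ, F δ ζ < δ) ∧
        ∀ E, IsClub E → ∃ δ ∈ {δ | δ ∈ S ∧ π δ = i}, δ ∈ limitPoints E ∧
          ∀ j, ∃ᶠ ζ in clubFilter (Below κ), (b δ ζ < F δ ζ ∧ F δ ζ ∈ E) ∧ g δ ζ = j := by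
    intro i
    obtain ⟨F, hF, hFE⟩ := exists_guess (al := b) (hπ i) fun δ hδ => hb δ hδ.1
    have : Nonempty (Below i.2.1) := ⟨⟨0, by simpa [Cardinal.lt_ord] using i.2.2.1⟩⟩
    obtain ⟨g, hg⟩ := exists_colouring hYX
      (by rw [mk_below, mk_below, lift_lt]; exact i.2.2.2.1) i.2.2.2.2 hFE
    exact ⟨F, g, hF, hg⟩
  choose F g hF hg using hguess
  have hfol : ∀ δ, ∃ a : Below κ → Below (Order.succ κ), δ ∈ S → IsLadder δ a ∧
      ((π δ).1 < δ → ∀ ζ, IsMin ζ → a ζ = (π δ).1) ∧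
      ∀ᶠ ζ in clubFilter (Below κ), a ζ = b δ ζ ∧ (b δ ζ < F (π δ) δ ζ →
        a (Order.succ ζ) = F (π δ) δ ζ) := by
    intro δ
    by_cases hδ : δ ∈ S
    · obtain ⟨γ, hγ, hγ'⟩ : ∃ γ < δ, (π δ).1 < δ → γ = (π δ).1 := by
        by_cases h : (π δ).1 < δ
        · exact ⟨_, h, fun _ => rfl⟩
        · obtain ⟨ζ⟩ := nonempty_of_uncountable (Below κ)
          exact ⟨_, (hb δ hδ).lt ζ, fun h' => (h h').elim⟩
      obtain ⟨a, ha, hmin, hev⟩ := (hb δ hδ).exists_follow hγ (hF (π δ) δ ⟨hδ, rfl⟩)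
      exact ⟨a, fun _ => ⟨ha, fun h ζ hζ => (hmin ζ hζ).trans (hγ' h),
        hev.mono fun ζ hζ => ⟨hζ.1, hζ.2 _ (Order.covBy_succ ζ)⟩⟩⟩
    · exact ⟨fun _ => δ, fun h => (hδ h).elim⟩
  choose a ha using hfol
  let χ : Below (Order.succ κ) → Cardinal.{u} := fun δ => (π δ).2.1
  let h : Below (Order.succ κ) → Below (Order.succ κ) → Ordinal.{u} := fun δ β =>
    if H : ∃ ζ, a δ ζ = β then (g (π δ) δ H.choose : Ordinal.{u}) else 0
  have hh : ∀ δ ∈ S, ∀ ζ, h δ (a δ ζ) = g (π δ) δ ζ := by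
    intro δ hδ ζ
    have H : ∃ ζ', a δ ζ' = a δ ζ := ⟨ζ, rfl⟩
    have hζ : H.choose = ζ := (ha δ hδ).1.isNormal.strictMono.injective H.choose_spec
    simp only [h, dif_pos H, hζ]
  have key : ∀ i : Below (Order.succ κ) × Q, ∀ E, IsClub E →
      ∃ δ ∈ guessSet S a h χ E univ, π δ = i ∧ i.1 < δ := by
    intro i E hE
    -- Intersecting with `Ioi i.1` forces `i.1 < δ`, so that the ladder really starts at the
    -- prescribed point.
    obtain ⟨δ, ⟨hδ, rfl⟩, hlim, hfr⟩ := hg i (E ∩ Ioi i.1)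
      (hE.inter UncountableRegularOrder.aleph0_lt_cof.ne' (isClub_Ioi _))
    obtain ⟨ζ₀⟩ := nonempty_of_uncountable (Below κ)
    obtain ⟨γ, hγ, -, hγδ⟩ := hlim _ ((hb δ hδ).lt ζ₀)
    have hlt : (π δ).1 < δ := lt_trans hγ.2 hγδ
    have hδE : δ ∈ limitPoints E := limitPoints_mono inter_subset_left hlim
    refine ⟨δ, ⟨trivial, hδ, ⟨fun h0 => ?_, hδE⟩, fun j hj => ?_⟩, rfl, hlt⟩
    · have : (γ : Ordinal.{u}) < (δ : Ordinal.{u}) := hγδ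
      rw [h0] at this
      exact not_lt_zero this
    · rw [isStationary_iff_frequently]
      refine ((hfr ⟨j, hj⟩).and_eventually ((ha δ hδ).2.2.and
        ((ha δ hδ).1.eventually_mem hE hδE))).mono fun ζ hζ => ⟨?_, ?_, hζ.2.2⟩
      · rw [hζ.2.1.2 hζ.1.1.1]
        exact hζ.1.1.2.1
      · rw [hh δ hδ, hζ.1.2]
  have hnormal : IsNormalFilter (guessFilter (fun E => guessSet S a h χ E univ)
      (guessSet_mono univ)) := isNormalFilter_guessFilter (fun δ hδ => (ha δ hδ).1) fun E hE => by
    obtain ⟨δ, hδ, -⟩ := key (Classical.arbitrary _) E hE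
    exact ⟨δ, hδ⟩
  refine ⟨_, fun δ => range (a δ), a, h, χ, hnormal, fun δ hδ => ⟨?_, (ha δ hδ).1.isClub_range,
    (ha δ hδ).1.isNormal, rfl⟩, fun δ hδ => ⟨(π δ).2.2.2.1.le, ?_⟩, fun A hA E hE => ?_,
    fun γ χ₀ hχ₀ => ?_⟩
  · rintro _ ⟨ζ, rfl⟩
    exact (ha δ hδ).1.lt ζ
  · rintro _ ⟨ζ, rfl⟩
    rw [hh δ hδ]
    exact (g (π δ) δ ζ).2
  · have hpos : Positive (guessFilter (fun E => guessSet S a h χ E univ) (guessSet_mono univ))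
        (guessSet S a h χ E A) := by
      intro hc
      refine hA (Filter.mem_of_superset (Filter.inter_mem hc ⟨E, hE, subset_rfl⟩) ?_)
      rintro δ ⟨h1, h2⟩ hδA
      exact h1 (by rw [guessSet_eq_inter]; exact ⟨hδA, h2⟩)
    obtain ⟨ζ⟩ := nonempty_of_uncountable (Below κ)
    obtain ⟨α, hα⟩ := hnormal.exists_positive_fiber hpos (f := fun δ => a δ ζ)
      fun δ hδ => (ha δ hδ.2.1).1.lt ζ
    exact ⟨hpos, α, ζ, hα⟩
  · rintro ⟨E, hE, hsub⟩
    obtain ⟨δ, hδ, hπδ, hlt⟩ := key (γ, ⟨χ₀, splits_of_admissible hreg hunc hχ₀⟩) E hE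
    refine hsub hδ ⟨hδ.2.1, ?_, by simp only [χ, hπδ]⟩
    have hmin := (ha δ hδ.2.1).2.1 (by rw [hπδ]; exact hlt)
    have h0 : (0 : Ordinal.{u}) < κ.ord := hreg.ord_pos
    have hbot : ∀ ζ : Below κ, (⟨0, h0⟩ : Below κ) ≤ ζ := fun ζ =>
      Subtype.coe_le_coe.1 zero_le
    have h1 := hmin ⟨0, h0⟩ fun ζ _ => hbot ζ
    rw [hπδ] at h1
    refine ⟨⟨_, h1⟩, ?_⟩
    rintro _ ⟨ζ, rfl⟩
    refine h1.symm.trans_le ?_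
    exact (ha δ hδ.2.1).1.isNormal.monotone (hbot ζ)
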